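/- For every $\epsilon>0$ there is $\delta=\delta(\epsilon)>0$ such that the following holds. Let $q=p^\ell$ be an odd prime power and let $\varphi:\mathbb{Z}_{\ge 0}\to\mathbb{R}$ satisfy $\varphi(r)=o(r)$ as $r\to\infty$. Then there is a constant $C>0$, depending only on $\epsilon$, on the fixed field $\mathbb{F}_q$ and on $\varphi$, such that for every $F\in\mathbb{F}_q[T]$ of degree $r$ (arbitrary, not necessarily irreducible or square-free), every $a\in\mathbb{F}_q[T]$ coprime to $F$, all positive integers $m,n$ with $$n\ge r\epsilon\quad\text{and}\quad m\ge r\left(\tfrac14+\epsilon\right),$$ and all complex weights $\alpha=(\alpha_{x_1})_{\deg x_1<m}$, $\beta=(\beta_{x_2})_{\deg x_2<n}$ with $\|\alpha\|_\infty,\|\beta\|_\infty\le q^{\varphi(r)}$, one has $$\Bigl|\sum_{\substack{\deg x_1<m\\(x_1,F)=1}}\ \sum_{\substack{\deg x_2<n\\(x_2,F)=1}}\alpha_{x_1}\beta_{x_2}\,e_F(a\,\overline{x_1x_2})\Bigr|\le C\,q^{m+n-r\delta}.$$ Here $\overline{x}$ is the inverse of $x$ modulo $F$, and $e_F(x)=e(x/F)$,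 where on Laurent series in $1/T$ over $\mathbb{F}_q$ we put $e\bigl(\sum_{i\le N}a_iT^i\bigr)=\exp\bigl(\tfrac{2\pi i}{p}\mathrm{Tr}(a_{-1})\bigr)$ with $\mathrm{Tr}:\mathbb{F}_q\to\mathbb{F}_p$ the absolute trace; the zero polynomial counts as having degree less than every integer. -/

import Mathlib

open Polynomial

namespace FqKloosterman

noncomputable section

/-- The embedding of `K[T]` into the field of Laurent series in `1/T` over `K`.  A Laurent series
in `1/T` is written as an element of `LaurentSeries K` in the uniformizer `1/T`, so that
`coeff i` is the coefficient of `T ^ (-i)`; in particular `T` is sent to `single (-1) 1`. -/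
def toInfty (K : Type*) [Field K] : K[X] →+* LaurentSeries K :=
  Polynomial.eval₂RingHom HahnSeries.C (HahnSeries.single (-1 : ℤ) (1 : K))

/-- The absolute trace of the field `K` down to its prime field, for `K` of positive
characteristic. -/
def absTrace (K : Type*) [Field K] (c : K) : ZMod (ringChar K) :=
  letI : Algebra (ZMod (ringChar K)) K := ZMod.algebra K (ringChar K)
  Algebra.trace (ZMod (ringChar K)) K c

/-- The additive character `e(∑ a_i T^i) = exp (2 π i Tr (a_{-1}) / p)` on Laurent series
in `1/T`, where `p` is the characteristic of `K`. -/
def eInfty {K : Type*} [Field K] (z : LaurentSeries K) : ℂ :=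
  Complex.exp (2 * Real.pi * Complex.I / (ringChar K : ℂ) * ((absTrace K (z.coeff 1)).val : ℂ))

/-- `e_F(x) = e(x / F)`, the quotient being taken in the field of Laurent series in `1/T`. -/
def eMod {K : Type*} [Field K] (F x : K[X]) : ℂ :=
  eInfty (toInfty K x / toInfty K F)

open Classical in
/-- The inverse of `x` modulo `F`, reduced modulo `F` (and `0` if `x` is not invertible). -/
def invMod {K : Type*} [Field K] (F x : K[X]) : K[X] :=
  if h : ∃ y : K[X], F ∣ x * y - 1 then h.choose % F else 0

theorem finite_degree_lt (K : Type*) [Field K] [Finite K] (n : ℕ) :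
    {x : K[X] | x.degree < (n : WithBot ℕ)}.Finite := by
  have : Finite (Polynomial.degreeLT K n) :=
    Finite.of_equiv _ (Polynomial.degreeLTEquiv K n).symm.toEquiv
  refine (Set.toFinite (Polynomial.degreeLT K n : Set K[X])).subset ?_
  intro x hx
  exact Polynomial.mem_degreeLT.2 hx

open Classical in
/-- The polynomials `x` with `deg x < n` and `(x, F) = 1` (where `deg 0 = ⊥`). -/
def coprimeLT {K : Type*} [Field K] [Finite K] (F : K[X]) (n : ℕ) : Finset K[X] :=
  (finite_degree_lt K n).toFinset.filter (fun x => IsCoprime x F)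

/-- The bilinear Kloosterman sum `W_{F,a}(m, n; α, β)`. -/
def bilinearSum {K : Type*} [Field K] [Finite K] (F a : K[X]) (m n : ℕ) (α β : K[X] → ℂ) : ℂ :=
  ∑ x₁ ∈ coprimeLT F m, ∑ x₂ ∈ coprimeLT F n, α x₁ * β x₂ * eMod F (a * invMod F (x₁ * x₂))

end

end FqKloosterman

/-!
Let `q` be the order of the field and `E_k(n)` the number of solutions of
`1/x₁ + ⋯ + 1/x_k = 1/y₁ + ⋯ + 1/y_k` modulo `F` in polynomials of degree `< n` coprime to `F`.
Hölder's inequality and the orthogonality of the additive characters modulo `F` bound the `4k`-th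
power of the bilinear sum by `q ^ (4 (k - 1) m + 2 k n + r) E₂(m) E_k(n)`, so it is enough to save
slightly more than `q ^ r` over the trivial bound in the product of the two energies.

* `E_k(n)` with `k` about `r / (2 n)` saves `q ^ (r / 2 - o(r))`. Clearing denominators, a solution
  gives a multiple `c` of `F` of degree `< 2 k n`. If `c = 0`, then the product of all the variables
  is powerful. If `c ≠ 0`, then `c` and the `xᵢ` determine `∏ yᵢ` modulo `∏ xᵢ / g` for some common
  divisor `g` of `c` and `∏ xᵢ`. In both cases the divisor bound recovers the variables from their
  products.
* `E₂(m)` saves `q ^ ((1 / 2 + κ) r)` as soon as `m ≥ (1 / 4 + κ) r`. By Dirichlet approximation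
  `1/x + 1/z = y` becomes `u x z ≡ v (x + z)` with `u` and `v` of small degree, and `v² + u c`
  factors as `(u x - v) (u z - v)` when `u x z - v (x + z) = c`. The case `u = 0` forces `x + z` to
  share a large factor with `F`.
-/

namespace FqKloosterman

section Character

variable {K : Type*} [Field K]

theorem toInfty_C (c : K) : toInfty K (C c) = HahnSeries.C c := by
  simp [toInfty]

theorem toInfty_monomial (n : ℕ) (c : K) :
    toInfty K (monomial n c) = HahnSeries.single (-(n : ℤ)) c := by
  simp [toInfty, HahnSeries.single_pow, HahnSeries.C_apply, HahnSeries.single_mul_single]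

theorem coeff_toInfty (x : K[X]) (i : ℤ) :
    (toInfty K x).coeff i = if i ≤ 0 then x.coeff (-i).toNat else 0 := by
  induction x using Polynomial.induction_on' with
  | add p q hp hq =>
    rw [map_add, HahnSeries.coeff_add, hp, hq]
    split_ifs <;> simp
  | monomial n c =>
    rw [toInfty_monomial, HahnSeries.coeff_single, coeff_monomial]
    grind

theorem toInfty_ne_zero {x : K[X]} (hx : x ≠ 0) : toInfty K x ≠ 0 := by
  intro h
  have hcoeff := coeff_toInfty x (-(x.natDegree : ℤ))
  rw [h, HahnSeries.coeff_zero] at hcoeff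
  exact hx (by simpa using hcoeff.symm)

theorem order_toInfty {x : K[X]} (hx : x ≠ 0) :
    (toInfty K x).order = -(x.natDegree : ℤ) := by
  apply le_antisymm
  · apply HahnSeries.order_le_of_coeff_ne_zero
    simpa [coeff_toInfty] using hx
  · by_contra! h
    have hcoeff := HahnSeries.coeff_order_eq_zero.not.2 (toInfty_ne_zero hx)
    rw [coeff_toInfty, if_pos (by omega), coeff_eq_zero_of_natDegree_lt (by omega)] at hcoeff
    exact hcoeff rfl

/-- The residue of `x / F` at infinity: the coefficient of `T⁻¹` in its Laurent expansion, through
which `eMod F` depends on `x`. It vanishes identically for `F = 0`. -/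
noncomputable def residue (F : K[X]) : K[X] →ₗ[K] K where
  toFun x := (toInfty K x / toInfty K F).coeff 1
  map_add' x y := by rw [map_add, add_div, HahnSeries.coeff_add]
  map_smul' c x := by
    rw [smul_eq_C_mul, map_mul, toInfty_C, mul_div_assoc, HahnSeries.C_mul_eq_smul,
      HahnSeries.coeff_smul, RingHom.id_apply]

theorem residue_apply (F x : K[X]) :
    residue F x = (toInfty K x / toInfty K F).coeff 1 := rfl

theorem residue_mul_left (F x : K[X]) : residue F (F * x) = 0 := by
  rcases eq_or_ne F 0 with rfl | hF
  · simp
  · rw [residue_apply, map_mul, mul_div_cancel_left₀ _ (toInfty_ne_zero hF), coeff_toInfty]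
    simp

theorem residue_ne_zero {F x : K[X]} (hx : x ≠ 0) (h : x.natDegree + 1 = F.natDegree) :
    residue F x ≠ 0 := by
  have hF : F ≠ 0 := by rintro rfl; simp at h
  set z := toInfty K x / toInfty K F
  have hz : z ≠ 0 := div_ne_zero (toInfty_ne_zero hx) (toInfty_ne_zero hF)
  have horder : z.order = 1 := by
    have hmul := HahnSeries.order_mul hz (toInfty_ne_zero hF)
    rw [div_mul_cancel₀ _ (toInfty_ne_zero hF), order_toInfty hx, order_toInfty hF] at hmul
    omega
  rw [residue_apply, ← horder]
  exact HahnSeries.coeff_order_eq_zero.not.2 hz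

theorem exists_residue_mul_ne_zero {F x : K[X]} (hF : F ≠ 0) (hx : ¬ F ∣ x) :
    ∃ y, residue F (x * y) ≠ 0 := by
  have hmod : x % F ≠ 0 := fun h => hx (EuclideanDomain.mod_eq_zero.1 h)
  have hlt : (x % F).natDegree < F.natDegree :=
    natDegree_lt_natDegree hmod (EuclideanDomain.mod_lt x hF)
  set k := F.natDegree - 1 - (x % F).natDegree
  refine ⟨X ^ k, ?_⟩
  rw [← EuclideanDomain.div_add_mod x F, add_mul, map_add, mul_assoc, residue_mul_left, zero_add]
  refine residue_ne_zero (mul_ne_zero hmod (pow_ne_zero _ X_ne_zero)) ?_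
  rw [natDegree_mul_X_pow _ hmod]
  omega

/-- The residue at infinity as a map on `K[T] / F`. -/
noncomputable def quotResidue (F : K[X]) : AdjoinRoot F →+ K :=
  QuotientAddGroup.lift (Ideal.span {F}).toAddSubgroup (residue F).toAddMonoidHom fun x hx => by
    obtain ⟨y, rfl⟩ := Ideal.mem_span_singleton.1 hx
    exact residue_mul_left F y

theorem quotResidue_mk (F x : K[X]) : quotResidue F (AdjoinRoot.mk F x) = residue F x := rfl

theorem finite_adjoinRoot [Finite K] {F : K[X]} (hF : F ≠ 0) : Finite (AdjoinRoot F) := by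
  have := (AdjoinRoot.powerBasis hF).finite
  exact Module.finite_of_finite K

theorem natCard_adjoinRoot {F : K[X]} (hF : F ≠ 0) :
    Nat.card (AdjoinRoot F) = Nat.card K ^ F.natDegree := by
  have := (AdjoinRoot.powerBasis hF).finite
  rw [Module.natCard_eq_pow_finrank (K := K), (AdjoinRoot.powerBasis hF).finrank,
    AdjoinRoot.powerBasis_dim]

variable [Finite K]

variable (K) in
/-- The additive character `c ↦ exp (2 π i Tr c / p)` of a finite field. -/
noncomputable def traceChar : AddChar K ℂ :=
  haveI : NeZero (ringChar K) := ⟨CharP.char_ne_zero_of_finite K (ringChar K)⟩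
  letI : Algebra (ZMod (ringChar K)) K := ZMod.algebra K (ringChar K)
  ZMod.stdAddChar.compAddMonoidHom (Algebra.trace (ZMod (ringChar K)) K).toAddMonoidHom

theorem eInfty_eq_traceChar (z : LaurentSeries K) : eInfty z = traceChar K (z.coeff 1) := by
  have : NeZero (ringChar K) := ⟨CharP.char_ne_zero_of_finite K (ringChar K)⟩
  change eInfty z = ZMod.stdAddChar (absTrace K (z.coeff 1))
  rw [ZMod.stdAddChar_apply, ZMod.toCircle_apply, eInfty]
  congr 1
  ring

theorem exists_traceChar_mul_ne_one {c : K} (hc : c ≠ 0) : ∃ b, traceChar K (c * b) ≠ 1 := by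
  have : NeZero (ringChar K) := ⟨CharP.char_ne_zero_of_finite K (ringChar K)⟩
  let : Algebra (ZMod (ringChar K)) K := ZMod.algebra K (ringChar K)
  obtain ⟨b, hb⟩ := FiniteField.trace_to_zmod_nondegenerate K hc
  exact ⟨b, fun h => hb (ZMod.injective_stdAddChar (h.trans (AddChar.map_zero_eq_one _).symm))⟩

/-- The additive character of `K[T] / F` induced by `eMod F`. -/
noncomputable def quotChar (F : K[X]) : AddChar (AdjoinRoot F) ℂ :=
  (traceChar K).compAddMonoidHom (quotResidue F)

theorem quotChar_mk (F x : K[X]) : quotChar F (AdjoinRoot.mk F x) = eMod F x := by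
  rw [eMod, eInfty_eq_traceChar, quotChar, AddChar.compAddMonoidHom_apply, quotResidue_mk,
    residue_apply]

theorem quotChar_isPrimitive {F : K[X]} (hF : F ≠ 0) : (quotChar F).IsPrimitive := by
  intro z hz htrivial
  obtain ⟨x, rfl⟩ := AdjoinRoot.mk_surjective z
  obtain ⟨y, hy⟩ := exists_residue_mul_ne_zero hF fun h => hz (AdjoinRoot.mk_eq_zero.2 h)
  obtain ⟨b, hb⟩ := exists_traceChar_mul_ne_one hy
  apply hb
  have hone := DFunLike.congr_fun htrivial (AdjoinRoot.mk F (b • y))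
  rw [AddChar.mulShift_apply, ← map_mul, mul_smul_comm, quotChar,
    AddChar.compAddMonoidHom_apply, quotResidue_mk, map_smul, smul_eq_mul] at hone
  rwa [mul_comm]

end Character

section Inverse

open scoped Ring

variable {K : Type*} [Field K]

theorem isUnit_mk_iff {R : Type*} [CommRing R] {F x : R[X]} :
    IsUnit (AdjoinRoot.mk F x) ↔ IsCoprime x F := by
  rw [isUnit_iff_exists_inv]
  constructor
  · rintro ⟨z, hz⟩
    obtain ⟨y, rfl⟩ := AdjoinRoot.mk_surjective z
    rw [← map_mul, ← map_one (AdjoinRoot.mk F), AdjoinRoot.mk_eq_mk] at hz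
    obtain ⟨t, ht⟩ := hz
    exact ⟨y, -t, by linear_combination ht⟩
  · rintro ⟨a, b, hab⟩
    refine ⟨AdjoinRoot.mk F a, ?_⟩
    rw [← map_mul, ← map_one (AdjoinRoot.mk F), AdjoinRoot.mk_eq_mk]
    exact ⟨-b, by linear_combination hab⟩

theorem mk_invMod (F x : K[X]) : AdjoinRoot.mk F (invMod F x) = (AdjoinRoot.mk F x)⁻¹ʳ := by
  by_cases h : ∃ y : K[X], F ∣ x * y - 1
  · have hmod : AdjoinRoot.mk F (h.choose % F) = AdjoinRoot.mk F h.choose := by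
      rw [AdjoinRoot.mk_eq_mk]
      exact ⟨-(h.choose / F), by linear_combination EuclideanDomain.div_add_mod h.choose F⟩
    have hinv : AdjoinRoot.mk F h.choose * AdjoinRoot.mk F x = 1 := by
      rw [← map_mul, ← map_one (AdjoinRoot.mk F), AdjoinRoot.mk_eq_mk, mul_comm]
      exact h.choose_spec
    rw [invMod, dif_pos h, hmod, ← one_mul (Ring.inverse _),
      Ring.eq_mul_inverse_iff_mul_eq _ _ _ (.of_mul_eq_one_right _ hinv), hinv]
  · have hunit : ¬ IsUnit (AdjoinRoot.mk F x) := by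
      rw [isUnit_mk_iff]
      rintro ⟨a, b, hab⟩
      exact h ⟨a, -b, by linear_combination hab⟩
    rw [invMod, dif_neg h, map_zero, Ring.inverse_non_unit _ hunit]

end Inverse

section Energy

open Finset

variable {ι R : Type*}

open Classical in
/-- The representations of `y` as a sum of `k` values of the family `u` on `A`. -/
noncomputable def sumReps [AddCommMonoid R] (A : Finset ι) (u : ι → R) (k : ℕ) (y : R) :
    Finset (Fin k → ι) :=
  {s ∈ Fintype.piFinset fun _ => A | ∑ i, u (s i) = y}

open Classical in
/-- The additive energy of order `k` of the family `u` on `A`: the number of solutions of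
`u x₁ + ⋯ + u xₖ = u y₁ + ⋯ + u yₖ`. -/
noncomputable def energy [AddCommMonoid R] (A : Finset ι) (u : ι → R) (k : ℕ) : ℕ :=
  #{p ∈ Fintype.piFinset (fun _ : Fin k => A) ×ˢ Fintype.piFinset (fun _ : Fin k => A) |
    ∑ i, u (p.1 i) = ∑ i, u (p.2 i)}

theorem mem_sumReps [AddCommMonoid R] {A : Finset ι} {u : ι → R} {k : ℕ} {y : R}
    {s : Fin k → ι} : s ∈ sumReps A u k y ↔ (∀ i, s i ∈ A) ∧ ∑ i, u (s i) = y := by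
  classical
  simp only [sumReps, mem_filter, Fintype.mem_piFinset]

theorem energy_eq_sum [AddCommMonoid R] (A : Finset ι) (u : ι → R) (k : ℕ) :
    energy A u k =
      ∑ s ∈ Fintype.piFinset fun _ : Fin k => A, #(sumReps A u k (∑ i, u (s i))) := by
  classical
  simp only [energy, sumReps, card_filter, sum_product_right]

theorem sum_piFinset_comp_sum [AddCommMonoid R] [Fintype R] {M : Type*} [Semiring M]
    (A : Finset ι) (u : ι → R) (k : ℕ) (f : R → M) :
    ∑ s ∈ Fintype.piFinset fun _ : Fin k => A, f (∑ i, u (s i)) =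
      ∑ y, #(sumReps A u k y) * f y := by
  classical
  rw [← sum_fiberwise _ (fun s : Fin k → ι => ∑ i, u (s i))]
  refine sum_congr rfl fun y _ => ?_
  rw [sum_congr rfl (g := fun _ => f y) fun s hs => by rw [(mem_filter.1 hs).2], sum_const,
    nsmul_eq_mul, sumReps]

theorem sum_card_sumReps [AddCommMonoid R] [Fintype R] (A : Finset ι) (u : ι → R) (k : ℕ) :
    ∑ y, #(sumReps A u k y) = #A ^ k := by
  rw [← Fintype.card_piFinset_const, card_eq_sum_ones]
  simpa using (sum_piFinset_comp_sum A u k fun _ => (1 : ℕ)).symm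

theorem sum_card_sumReps_sq [AddCommMonoid R] [Fintype R] (A : Finset ι) (u : ι → R) (k : ℕ) :
    ∑ y, #(sumReps A u k y) ^ 2 = energy A u k := by
  simpa only [energy_eq_sum, sq, Nat.cast_id] using
    (sum_piFinset_comp_sum A u k fun y => #(sumReps A u k y)).symm

theorem energy_mul_left [CommRing R] (A : Finset ι) (u : ι → R) (k : ℕ) {c : R}
    (hc : IsUnit c) : energy A (fun x => c * u x) k = energy A u k := by
  unfold energy
  congr 1
  ext p
  simp only [mem_filter, ← mul_sum, hc.mul_right_inj]

open Classical in
theorem card_sumReps_succ_le [AddCommGroup R] {A : Finset ι} {u : ι → R} {M : ℕ}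
    (hM : ∀ y, #{x ∈ A | u x = y} ≤ M) (k : ℕ) (y : R) :
    #(sumReps A u (k + 1) y) ≤ M * #A ^ k := by
  have tail_mem (s : Fin (k + 1) → ι) (hs : s ∈ sumReps A u (k + 1) y) :
      Fin.tail s ∈ Fintype.piFinset fun _ : Fin k => A :=
    Fintype.mem_piFinset.2 fun i => (mem_sumReps.1 hs).1 i.succ
  rw [← Fintype.card_piFinset_const]
  refine card_le_mul_card_image_of_maps_to tail_mem M fun t _ => ?_
  have head_eq (s : Fin (k + 1) → ι) (hs : s ∈ sumReps A u (k + 1) y) (ht : Fin.tail s = t) :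
      u (s 0) = y - ∑ i, u (t i) := by
    rw [← (mem_sumReps.1 hs).2, ← ht, Fin.sum_univ_succ]
    exact (add_sub_cancel_right _ _).symm
  refine (card_le_card_of_injOn (fun s : Fin (k + 1) → ι => s 0) (fun s hs => ?_) ?_).trans
    (hM (y - ∑ i, u (t i)))
  · obtain ⟨hs, ht⟩ := mem_filter.1 hs
    exact mem_filter.2 ⟨(mem_sumReps.1 hs).1 0, head_eq s hs ht⟩
  · intro s hs s' hs' (h : s 0 = s' 0)
    rw [← Fin.cons_self_tail s, ← Fin.cons_self_tail s', (mem_filter.1 hs).2,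
      (mem_filter.1 hs').2, h]

open Classical in
theorem energy_succ_le [AddCommGroup R] {A : Finset ι} {u : ι → R} {M : ℕ}
    (hM : ∀ y, #{x ∈ A | u x = y} ≤ M) (k : ℕ) :
    energy A u (k + 1) ≤ M * #A ^ (2 * k + 1) := by
  rw [energy_eq_sum]
  refine (sum_le_card_nsmul _ _ _ fun s _ => card_sumReps_succ_le hM k _).trans_eq ?_
  rw [Fintype.card_piFinset_const, smul_eq_mul]
  ring

end Energy

section CharacterSums

open Finset

variable {ι κ R : Type*} [CommRing R]

theorem map_sum_eq_prod {R : Type*} [AddCommMonoid R] (ψ : AddChar R ℂ) (s : Finset ι) (f : ι → R) :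
    ψ (∑ i ∈ s, f i) = ∏ i ∈ s, ψ (f i) :=
  map_prod ψ.toMonoidHom (fun i => Multiplicative.ofAdd (f i)) s

theorem pow_charSum (ψ : AddChar R ℂ) (A : Finset ι) (u : ι → R) (θ : ι → ℂ) (k : ℕ) (y : R) :
    (∑ i ∈ A, θ i * ψ (u i * y)) ^ k =
      ∑ s ∈ Fintype.piFinset fun _ : Fin k => A, (∏ j, θ (s j)) * ψ ((∑ j, u (s j)) * y) := by
  rw [sum_pow']
  refine sum_congr rfl fun s _ => ?_
  rw [prod_mul_distrib, sum_mul, map_sum_eq_prod]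

theorem norm_prod_le_one {A : Finset ι} {θ : ι → ℂ} (hθ : ∀ i ∈ A, ‖θ i‖ ≤ 1) {k : ℕ}
    {s : Fin k → ι} (hs : ∀ j, s j ∈ A) : ‖∏ j, θ (s j)‖ ≤ 1 := by
  rw [norm_prod]
  exact prod_le_one (fun _ _ => norm_nonneg _) fun j _ => hθ _ (hs j)

theorem sum_norm_sq_charSum [Fintype R] {ψ : AddChar R ℂ} (hψ : ψ.IsPrimitive) (c : R → ℂ) :
    ∑ y, ‖∑ z, c z * ψ (z * y)‖ ^ 2 = Fintype.card R * ∑ z, ‖c z‖ ^ 2 := by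
  classical
  have expand (y : R) : (∑ z, c z * ψ (z * y)) * (starRingEnd ℂ) (∑ z, c z * ψ (z * y)) =
      ∑ z, ∑ w, c z * (starRingEnd ℂ) (c w) * ψ (y * (z - w)) := by
    rw [map_sum, sum_mul_sum]
    refine sum_congr rfl fun z _ => sum_congr rfl fun w _ => ?_
    rw [map_mul (starRingEnd ℂ), ← AddChar.map_neg_eq_conj,
      show y * (z - w) = z * y + -(w * y) by ring, AddChar.map_add_eq_mul]
    ring
  have orthogonality (z : R) : ∑ y, ∑ w, c z * (starRingEnd ℂ) (c w) * ψ (y * (z - w)) =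
      Fintype.card R * (‖c z‖ : ℂ) ^ 2 := by
    rw [sum_comm]
    simp only [← mul_sum, AddChar.sum_mulShift _ hψ, sub_eq_zero, Nat.cast_ite, Nat.cast_zero,
      mul_ite, mul_zero, sum_ite_eq, mem_univ, if_true, Complex.mul_conj']
    exact mul_comm _ _
  have h : ((∑ y, ‖∑ z, c z * ψ (z * y)‖ ^ 2 : ℝ) : ℂ) =
      ((Fintype.card R * ∑ z, ‖c z‖ ^ 2 : ℝ) : ℂ) := by
    push_cast
    simp only [← Complex.mul_conj', expand]
    rw [sum_comm, sum_congr rfl fun z _ => orthogonality z, mul_sum]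
    simp only [Complex.mul_conj']
  exact_mod_cast h

theorem sum_norm_charSum_pow_le [Fintype R] {ψ : AddChar R ℂ} (hψ : ψ.IsPrimitive)
    (A : Finset ι) (u : ι → R) {θ : ι → ℂ} (hθ : ∀ i ∈ A, ‖θ i‖ ≤ 1) (k : ℕ) :
    ∑ y, ‖∑ i ∈ A, θ i * ψ (u i * y)‖ ^ (2 * k) ≤ Fintype.card R * energy A u k := by
  classical
  let c (z : R) : ℂ := ∑ s ∈ sumReps A u k z, ∏ j, θ (s j)
  have hpow (y : R) : (∑ i ∈ A, θ i * ψ (u i * y)) ^ k = ∑ z, c z * ψ (z * y) := by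
    rw [pow_charSum, ← sum_fiberwise _ fun s => ∑ j, u (s j)]
    refine sum_congr rfl fun z _ => ?_
    rw [sum_mul]
    exact sum_congr rfl fun s hs => by rw [(mem_filter.1 hs).2]
  have hc (z : R) : ‖c z‖ ≤ #(sumReps A u k z) := by
    refine (norm_sum_le_of_le _ fun s hs => norm_prod_le_one hθ (mem_sumReps.1 hs).1).trans_eq ?_
    simp
  calc ∑ y, ‖∑ i ∈ A, θ i * ψ (u i * y)‖ ^ (2 * k)
      = ∑ y, ‖∑ z, c z * ψ (z * y)‖ ^ 2 := by
        simp only [← hpow, norm_pow, ← pow_mul, mul_comm k]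
    _ = Fintype.card R * ∑ z, ‖c z‖ ^ 2 := sum_norm_sq_charSum hψ c
    _ ≤ Fintype.card R * energy A u k := by
        rw [← sum_card_sumReps_sq]
        push_cast
        gcongr with z
        exact hc z

theorem exists_sum_norm_charSum_pow_le [Fintype R] (ψ : AddChar R ℂ) (A : Finset ι)
    (B : Finset κ) (u : ι → R) (v : κ → R) {β : κ → ℂ} (hβ : ∀ j ∈ B, ‖β j‖ ≤ 1) (k : ℕ) :
    ∃ θ : ι → ℂ, (∀ i, ‖θ i‖ = 1) ∧
      ∑ i ∈ A, ‖∑ j ∈ B, β j * ψ (v j * u i)‖ ^ k ≤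
        ∑ y, #(sumReps B v k y) * ‖∑ i ∈ A, θ i * ψ (u i * y)‖ := by
  choose θ hθ hphase using fun i =>
    Complex.exists_norm_eq_mul_self ((∑ j ∈ B, β j * ψ (v j * u i)) ^ k)
  refine ⟨θ, hθ, ?_⟩
  have expand : ((∑ i ∈ A, ‖∑ j ∈ B, β j * ψ (v j * u i)‖ ^ k : ℝ) : ℂ) =
      ∑ s ∈ Fintype.piFinset fun _ : Fin k => B, (∏ j, β (s j)) *
        ∑ i ∈ A, θ i * ψ (u i * ∑ j, v (s j)) := by
    simp only [← norm_pow, Complex.ofReal_sum]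
    rw [sum_congr rfl fun i _ => hphase i]
    simp only [pow_charSum, mul_sum]
    rw [sum_comm]
    refine sum_congr rfl fun s _ => sum_congr rfl fun i _ => ?_
    rw [← mul_sum, mul_comm (u i)]
    ring
  calc ∑ i ∈ A, ‖∑ j ∈ B, β j * ψ (v j * u i)‖ ^ k
      = ‖((∑ i ∈ A, ‖∑ j ∈ B, β j * ψ (v j * u i)‖ ^ k : ℝ) : ℂ)‖ := by
        rw [Complex.norm_real, Real.norm_of_nonneg (by positivity)]
    _ ≤ ∑ s ∈ Fintype.piFinset fun _ : Fin k => B, ‖∑ i ∈ A, θ i * ψ (u i * ∑ j, v (s j))‖ := by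
        rw [expand]
        refine norm_sum_le_of_le _ fun s hs => ?_
        rw [norm_mul]
        exact mul_le_of_le_one_left (norm_nonneg _)
          (norm_prod_le_one hβ (Fintype.mem_piFinset.1 hs))
    _ = _ := sum_piFinset_comp_sum B v k fun y => ‖∑ i ∈ A, θ i * ψ (u i * y)‖

theorem norm_bilinear_le_sum (ψ : AddChar R ℂ) {A : Finset ι} (B : Finset κ) (u : ι → R)
    (v : κ → R) {α : ι → ℂ} (β : κ → ℂ) (hα : ∀ i ∈ A, ‖α i‖ ≤ 1) :
    ‖∑ i ∈ A, ∑ j ∈ B, α i * β j * ψ (u i * v j)‖ ≤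
      ∑ i ∈ A, ‖∑ j ∈ B, β j * ψ (v j * u i)‖ := by
  refine norm_sum_le_of_le _ fun i hi => ?_
  simp only [mul_assoc, ← mul_sum, norm_mul, mul_comm (u i)]
  exact mul_le_of_le_one_left (norm_nonneg _) (hα i hi)

theorem sum_mul_pow_four_le (s : Finset ι) {f : ι → ℝ} (g : ι → ℝ) (hf : ∀ y, 0 ≤ f y) :
    (∑ y ∈ s, f y * g y) ^ 4 ≤ (∑ y ∈ s, f y) ^ 2 * ((∑ y ∈ s, f y ^ 2) * ∑ y ∈ s, g y ^ 4) := by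
  have hfirst : (∑ y ∈ s, f y * g y) ^ 2 ≤ (∑ y ∈ s, f y) * ∑ y ∈ s, f y * g y ^ 2 := by
    have := sum_mul_sq_le_sq_mul_sq s (fun y => √(f y)) (fun y => √(f y) * g y)
    simpa only [← mul_assoc, Real.mul_self_sqrt (hf _), mul_pow, Real.sq_sqrt (hf _)] using this
  have hsecond : (∑ y ∈ s, f y * g y ^ 2) ^ 2 ≤ (∑ y ∈ s, f y ^ 2) * ∑ y ∈ s, g y ^ 4 := by
    have := sum_mul_sq_le_sq_mul_sq s f (fun y => g y ^ 2)
    simpa only [← pow_mul] using this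
  calc (∑ y ∈ s, f y * g y) ^ 4 = ((∑ y ∈ s, f y * g y) ^ 2) ^ 2 := by ring
    _ ≤ ((∑ y ∈ s, f y) * ∑ y ∈ s, f y * g y ^ 2) ^ 2 := pow_le_pow_left₀ (sq_nonneg _) hfirst 2
    _ = (∑ y ∈ s, f y) ^ 2 * (∑ y ∈ s, f y * g y ^ 2) ^ 2 := mul_pow _ _ _
    _ ≤ _ := mul_le_mul_of_nonneg_left hsecond (sq_nonneg _)

theorem norm_bilinear_pow_le [Fintype R] {ψ : AddChar R ℂ} (hψ : ψ.IsPrimitive)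
    {A : Finset ι} {B : Finset κ} (u : ι → R) (v : κ → R) {α : ι → ℂ} {β : κ → ℂ}
    (hα : ∀ i ∈ A, ‖α i‖ ≤ 1) (hβ : ∀ j ∈ B, ‖β j‖ ≤ 1) (l : ℕ) :
    ‖∑ i ∈ A, ∑ j ∈ B, α i * β j * ψ (u i * v j)‖ ^ (4 * (l + 1)) ≤
      (#A : ℝ) ^ (4 * l) * ((#B : ℝ) ^ (2 * (l + 1)) * (energy B v (l + 1) *
        (Fintype.card R * energy A u 2))) := by
  obtain ⟨θ, hθ, hsum⟩ := exists_sum_norm_charSum_pow_le ψ A B u v hβ (l + 1)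
  set ρ : R → ℝ := fun y => #(sumReps B v (l + 1) y)
  set σ : R → ℝ := fun y => ‖∑ i ∈ A, θ i * ψ (u i * y)‖
  have hρ : ∑ y, ρ y = (#B : ℝ) ^ (l + 1) := by
    simp only [ρ]
    exact_mod_cast sum_card_sumReps B v (l + 1)
  have hρ2 : ∑ y, ρ y ^ 2 = energy B v (l + 1) := by
    simp only [ρ]
    exact_mod_cast sum_card_sumReps_sq B v (l + 1)
  have hσ : ∑ y, σ y ^ 4 ≤ Fintype.card R * energy A u 2 :=
    sum_norm_charSum_pow_le hψ A u (fun i _ => (hθ i).le) 2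
  calc ‖∑ i ∈ A, ∑ j ∈ B, α i * β j * ψ (u i * v j)‖ ^ (4 * (l + 1))
      ≤ ((∑ i ∈ A, ‖∑ j ∈ B, β j * ψ (v j * u i)‖) ^ (l + 1)) ^ 4 := by
        rw [mul_comm 4, pow_mul]
        gcongr
        exact norm_bilinear_le_sum ψ B u v β hα
    _ ≤ (#A ^ l * ∑ i ∈ A, ‖∑ j ∈ B, β j * ψ (v j * u i)‖ ^ (l + 1)) ^ 4 := by
        gcongr
        exact pow_sum_le_card_mul_sum_pow (fun _ _ => norm_nonneg _) l
    _ ≤ (#A ^ l * ∑ y, ρ y * σ y) ^ 4 := by gcongr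
    _ = (#A : ℝ) ^ (4 * l) * (∑ y, ρ y * σ y) ^ 4 := by rw [mul_pow, ← pow_mul, mul_comm l]
    _ ≤ (#A : ℝ) ^ (4 * l) * ((∑ y, ρ y) ^ 2 * ((∑ y, ρ y ^ 2) * ∑ y, σ y ^ 4)) := by
        gcongr
        exact sum_mul_pow_four_le univ σ fun y => Nat.cast_nonneg _
    _ ≤ _ := by
        rw [hρ, hρ2, ← pow_mul, mul_comm (l + 1)]
        gcongr

end CharacterSums

section BoundedDegree

open Finset

variable (K : Type*) [Field K] [Finite K]

/-- The polynomials of degree less than `n`, including zero. -/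
noncomputable def polysLT (n : ℕ) : Finset K[X] := (finite_degree_lt K n).toFinset

open Classical in
/-- The nonzero polynomials of degree less than `n`. -/
noncomputable def nzLT (n : ℕ) : Finset K[X] := (polysLT K n).erase 0

theorem card_polysLT (n : ℕ) : #(polysLT K n) = Nat.card K ^ n := by
  have h : {x : K[X] | x.degree < n} = degreeLT K n := Set.ext fun _ => mem_degreeLT.symm
  rw [polysLT, ← Set.ncard_eq_toFinset_card _ (finite_degree_lt K n), h, ← Nat.card_coe_set_eq,
    SetLike.coe_sort_coe, Nat.card_congr (degreeLTEquiv K n).toEquiv, Nat.card_fun, Nat.card_fin]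

theorem card_nzLT_le (n : ℕ) : #(nzLT K n) ≤ Nat.card K ^ n :=
  (card_le_card fun _ => by classical exact mem_of_mem_erase).trans_eq (card_polysLT K n)

variable {K} {F d x y : K[X]} {n : ℕ}

theorem mem_polysLT : x ∈ polysLT K n ↔ x.degree < n := by
  simp [polysLT]

theorem mem_polysLT_of_ne_zero (hx : x ≠ 0) : x ∈ polysLT K n ↔ x.natDegree < n := by
  rw [mem_polysLT, natDegree_lt_iff_degree_lt hx]

theorem mem_nzLT : x ∈ nzLT K n ↔ x ≠ 0 ∧ x.natDegree < n := by
  classical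
  rw [nzLT, mem_erase]
  exact and_congr_right mem_polysLT_of_ne_zero

theorem mem_coprimeLT : x ∈ coprimeLT F n ↔ x ∈ polysLT K n ∧ IsCoprime x F := by
  simp [coprimeLT, polysLT]

theorem coprimeLT_subset_nzLT (hF : ¬ IsUnit F) : coprimeLT F n ⊆ nzLT K n := by
  classical
  intro x hx
  obtain ⟨hx, hcop⟩ := mem_coprimeLT.1 hx
  refine mem_erase.2 ⟨?_, hx⟩
  rintro rfl
  exact hF (isCoprime_zero_left.1 hcop)

theorem card_coprimeLT_le (F : K[X]) (n : ℕ) : #(coprimeLT F n) ≤ Nat.card K ^ n :=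
  (card_le_card fun _ hx => (mem_coprimeLT.1 hx).1).trans_eq (card_polysLT K n)

theorem div_mem_polysLT (hd : d ≠ 0) (hx : x ∈ polysLT K n) :
    x / d ∈ polysLT K (n - d.natDegree) := by
  rcases eq_or_ne (x / d) 0 with h | h
  · rw [h, mem_polysLT, degree_zero]
    exact WithBot.bot_lt_coe _
  · have hle : d.degree ≤ x.degree := not_lt.1 fun hlt => h ((Polynomial.div_eq_zero_iff hd).2 hlt)
    have hx0 : x ≠ 0 := by
      rintro rfl
      exact h (EuclideanDomain.zero_div)
    have hadd : d.natDegree + (x / d).natDegree = x.natDegree := by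
      have := degree_add_div hd hle
      rw [degree_eq_natDegree hd, degree_eq_natDegree h, degree_eq_natDegree hx0] at this
      exact_mod_cast this
    rw [mem_polysLT_of_ne_zero hx0] at hx
    rw [mem_polysLT_of_ne_zero h]
    omega

open Classical in
theorem card_polysLT_filter_dvd_sub_le (n : ℕ) (hd : d ≠ 0) (c : K[X]) :
    #{x ∈ polysLT K n | d ∣ x - c} ≤ Nat.card K ^ (n - d.natDegree) := by
  rw [← card_polysLT]
  refine card_le_card_of_injOn (· / d)
    (fun x hx => div_mem_polysLT hd (mem_filter.1 hx).1) fun x hx y hy (hxy : x / d = y / d) => ?_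
  have hmod : x % d = y % d := by
    rw [← sub_eq_zero, ← sub_mod, EuclideanDomain.mod_eq_zero]
    simpa only [sub_sub_sub_cancel_right] using dvd_sub (mem_filter.1 hx).2 (mem_filter.1 hy).2
  rw [← EuclideanDomain.div_add_mod x d, ← EuclideanDomain.div_add_mod y d, hmod, hxy]

open Classical in
theorem card_nzLT_filter_dvd_mul_le (n : ℕ) (hd : d ≠ 0) :
    #{x ∈ nzLT K n | d ∣ x} * Nat.card K ^ d.natDegree ≤ Nat.card K ^ n := by
  rcases le_or_gt d.natDegree n with h | h
  · rw [← Nat.sub_add_cancel h, pow_add, Nat.sub_add_cancel h]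
    gcongr
    refine (card_le_card fun x hx => ?_).trans (card_polysLT_filter_dvd_sub_le n hd 0)
    rw [mem_filter] at hx ⊢
    exact ⟨mem_of_mem_erase hx.1, by simpa using hx.2⟩
  · rw [filter_false_of_mem, card_empty, zero_mul]
    · exact Nat.zero_le _
    · intro x hx hdvd
      have := natDegree_le_of_dvd hdvd (mem_nzLT.1 hx).1
      have := (mem_nzLT.1 hx).2
      omega

open scoped Ring Classical in
theorem card_coprimeLT_filter_inverse_eq_le (hF : F ≠ 0) (n : ℕ) (y : AdjoinRoot F) :
    #{x ∈ coprimeLT F n | (AdjoinRoot.mk F x)⁻¹ʳ = y} ≤ Nat.card K ^ (n - F.natDegree) := by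
  rcases eq_empty_or_nonempty {x ∈ coprimeLT F n | (AdjoinRoot.mk F x)⁻¹ʳ = y} with h | ⟨c, hc⟩
  · simp [h]
  refine (card_le_card fun x hx => ?_).trans (card_polysLT_filter_dvd_sub_le n hF c)
  obtain ⟨hx, hxy⟩ := mem_filter.1 hx
  obtain ⟨hc, hcy⟩ := mem_filter.1 hc
  rw [mem_coprimeLT, ← isUnit_mk_iff] at hx hc
  rw [mem_filter, ← AdjoinRoot.mk_eq_mk, ← Ring.inverse_inverse hx.2, ← Ring.inverse_inverse hc.2,
    hxy, hcy]
  exact ⟨hx.1, rfl⟩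

end BoundedDegree

section Divisors

open Finset

variable {K : Type*} [Field K] [Finite K]

open Classical in
/-- The set of divisors of `x`, for `x ≠ 0`. -/
noncomputable def divs (x : K[X]) : Finset K[X] := {d ∈ polysLT K (x.natDegree + 1) | d ∣ x}

variable (K) in
/-- The divisor function of `K[T]`: the maximal number of divisors, units included, of a nonzero
polynomial of degree at most `N`. -/
noncomputable def maxDivs (N : ℕ) : ℕ := (nzLT K (N + 1)).sup fun x => #(divs x)

theorem mem_divs {x d : K[X]} (hx : x ≠ 0) : d ∈ divs x ↔ d ∣ x := by
  classical
  rw [divs, mem_filter, and_iff_right_iff_imp]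
  intro h
  rw [mem_polysLT_of_ne_zero (ne_zero_of_dvd_ne_zero hx h)]
  exact Nat.lt_succ_of_le (natDegree_le_of_dvd h hx)

theorem card_divs_le_maxDivs {x : K[X]} (hx : x ≠ 0) {N : ℕ} (h : x.natDegree ≤ N) :
    #(divs x) ≤ maxDivs K N :=
  le_sup (f := fun x => #(divs x)) (mem_nzLT.2 ⟨hx, Nat.lt_succ_of_le h⟩)

theorem maxDivs_mono : Monotone (maxDivs K) := fun _ _ h =>
  Finset.sup_le fun _ hx => card_divs_le_maxDivs (mem_nzLT.1 hx).1
    ((Nat.le_of_lt_succ (mem_nzLT.1 hx).2).trans h)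

theorem one_mem_nzLT (N : ℕ) : (1 : K[X]) ∈ nzLT K (N + 1) :=
  mem_nzLT.2 ⟨one_ne_zero, by simp⟩

theorem maxDivs_pos (N : ℕ) : 0 < maxDivs K N :=
  (card_pos.2 ⟨1, (mem_divs one_ne_zero).2 dvd_rfl⟩).trans_le
    (card_divs_le_maxDivs one_ne_zero (by simp))

open Classical UniqueFactorizationMonoid in
theorem card_divs_le_prod {x : K[X]} (hx : x ≠ 0) :
    #(divs x) ≤ Nat.card K *
      ∏ p ∈ (normalizedFactors x).toFinset, ((normalizedFactors x).count p + 1) := by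
  have := Fintype.ofFinite K
  rw [← Multiset.card_Iic, Nat.card_eq_fintype_card, ← card_univ, ← card_product]
  refine card_le_card_of_injOn (fun d => (d.leadingCoeff, normalizedFactors d)) ?_ ?_
  · intro d hd
    have hd := (mem_divs hx).1 hd
    simp only [coe_product, coe_univ, Set.mem_prod, Set.mem_univ, true_and, mem_coe, mem_Iic]
    exact (dvd_iff_normalizedFactors_le_normalizedFactors (ne_zero_of_dvd_ne_zero hx hd) hx).1 hd
  · intro d _ e _ hde
    obtain ⟨hlead, hfactors⟩ := Prod.mk.inj hde
    rw [← leadingCoeff_mul_prod_normalizedFactors d, ← leadingCoeff_mul_prod_normalizedFactors e,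
      hlead, hfactors]

open Classical UniqueFactorizationMonoid in
theorem sum_count_mul_natDegree {K : Type*} [Field K] {x : K[X]} (hx : x ≠ 0) :
    ∑ p ∈ (normalizedFactors x).toFinset, (normalizedFactors x).count p * p.natDegree =
      x.natDegree := by
  have hsum := sum_multiset_map_count (normalizedFactors x) natDegree
  simp only [smul_eq_mul] at hsum
  rw [← hsum, ← natDegree_multiset_prod _ (zero_notMem_normalizedFactors x)]
  exact natDegree_eq_of_degree_eq (degree_eq_degree_of_associated (prod_normalizedFactors hx))

theorem exists_succ_le_mul_pow {b : ℝ} (hb : 1 < b) :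
    ∃ B : ℝ, 1 ≤ B ∧ ∀ e : ℕ, (e + 1 : ℝ) ≤ B * b ^ e := by
  have hb' : 0 < b - 1 := by linarith
  refine ⟨1 + (b - 1)⁻¹, by simpa using hb'.le, fun e => ?_⟩
  have bernoulli := one_add_mul_le_pow (a := b - 1) (by linarith) e
  rw [add_sub_cancel] at bernoulli
  have hone : 1 ≤ b ^ e := one_le_pow₀ hb.le
  have he : (e : ℝ) ≤ (b - 1)⁻¹ * b ^ e := by
    rw [le_inv_mul_iff₀ hb']
    linarith
  linarith

theorem succ_le_ite_mul_pow {b B : ℝ} (hb : 1 ≤ b) (hB : ∀ e : ℕ, (e + 1 : ℝ) ≤ B * b ^ e)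
    {D : ℕ} (hD : 2 ≤ b ^ D) (e : ℕ) {d : ℕ} (hd : 1 ≤ d) :
    (e + 1 : ℝ) ≤ (if d < D then B else 1) * b ^ (e * d) := by
  split_ifs with h
  · have hB0 : 0 ≤ B := zero_le_one.trans (by simpa using hB 0)
    refine (hB e).trans ?_
    gcongr
    exact Nat.le_mul_of_pos_right _ hd
  · rw [one_mul, mul_comm, pow_mul]
    calc (e + 1 : ℝ) ≤ 2 ^ e := by exact_mod_cast Nat.succ_le_of_lt Nat.lt_two_pow_self
      _ ≤ (b ^ d) ^ e := by
        gcongr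
        exact hD.trans (pow_le_pow_right₀ hb (not_lt.1 h))

open Classical UniqueFactorizationMonoid in
theorem exists_card_divs_le (K : Type*) [Field K] [Finite K] {η : ℝ} (hη : 0 < η) :
    ∃ C : ℝ, 0 < C ∧ ∀ x : K[X], x ≠ 0 →
      (#(divs x) : ℝ) ≤ C * (Nat.card K : ℝ) ^ (η * x.natDegree) := by
  have hq : (1 : ℝ) < Nat.card K := by exact_mod_cast Finite.one_lt_card
  set b : ℝ := (Nat.card K : ℝ) ^ η
  have hb : 1 < b := Real.one_lt_rpow hq hη
  obtain ⟨B, hB1, hB⟩ := exists_succ_le_mul_pow hb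
  obtain ⟨D, hD⟩ := pow_unbounded_of_one_lt 2 hb
  refine ⟨Nat.card K * B ^ #(polysLT K D), by positivity, fun x hx => ?_⟩
  set M := normalizedFactors x
  have hirr (p) (hp : p ∈ M.toFinset) : Irreducible p :=
    irreducible_of_normalized_factor p (Multiset.mem_toFinset.1 hp)
  have hpow : (Nat.card K : ℝ) ^ (η * x.natDegree) =
      ∏ p ∈ M.toFinset, b ^ (M.count p * p.natDegree) := by
    rw [prod_pow_eq_pow_sum, sum_count_mul_natDegree hx, Real.rpow_mul (by positivity),
      Real.rpow_natCast]
  calc (#(divs x) : ℝ) ≤ Nat.card K * ∏ p ∈ M.toFinset, (M.count p + 1 : ℝ) := by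
        exact_mod_cast card_divs_le_prod hx
    _ ≤ Nat.card K * ∏ p ∈ M.toFinset,
          ((if p.natDegree < D then B else 1) * b ^ (M.count p * p.natDegree)) := by
        gcongr with p hp
        exact succ_le_ite_mul_pow hb.le hB hD.le _ (hirr p hp).natDegree_pos
    _ = Nat.card K * B ^ #{p ∈ M.toFinset | p.natDegree < D} *
          (Nat.card K : ℝ) ^ (η * x.natDegree) := by
        rw [prod_mul_distrib, ← hpow, prod_ite, prod_const, prod_const_one, mul_one, mul_assoc]
    _ ≤ _ := by
        gcongr
        intro p hp
        obtain ⟨hp, hdeg⟩ := mem_filter.1 hp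
        exact (mem_polysLT_of_ne_zero (hirr p hp).ne_zero).2 hdeg

theorem exists_maxDivs_le (K : Type*) [Field K] [Finite K] {η : ℝ} (hη : 0 < η) :
    ∃ C : ℝ, 0 < C ∧ ∀ N : ℕ, (maxDivs K N : ℝ) ≤ C * (Nat.card K : ℝ) ^ (η * N) := by
  obtain ⟨C, hC, h⟩ := exists_card_divs_le K hη
  refine ⟨C, hC, fun N => ?_⟩
  obtain ⟨x, hx, hsup⟩ := exists_mem_eq_sup _ ⟨1, one_mem_nzLT N⟩ fun x : K[X] => #(divs x)
  obtain ⟨hx0, hdeg⟩ := mem_nzLT.1 hx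
  have hq : (1 : ℝ) ≤ Nat.card K := by exact_mod_cast Nat.card_pos
  rw [maxDivs, hsup]
  refine (h x hx0).trans ?_
  gcongr
  omega

end Divisors

section Reciprocals

open Finset

section

variable {ι R : Type*} [Fintype ι] [DecidableEq ι] [CommRing R]

/-- The numerator of `∑ i, 1 / s i` over the denominator `∏ i, s i`. -/
def recipNum (s : ι → R) : R := ∑ i, ∏ j ∈ univ.erase i, s j

/-- The numerator of `∑ i, 1 / s i - ∑ i, 1 / t i` over the denominator `(∏ i, s i) * ∏ i, t i`. -/
def recipDiff (s t : ι → R) : R := (∏ i, t i) * recipNum s - (∏ i, s i) * recipNum t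

variable {s t : ι → R}

theorem recipDiff_swap (s t : ι → R) : recipDiff t s = -recipDiff s t :=
  (neg_sub _ _).symm

theorem map_recipNum {S : Type*} [CommRing S] (f : R →+* S) (s : ι → R) :
    f (recipNum s) = recipNum fun i => f (s i) := by
  simp only [recipNum, map_sum, map_prod]

theorem map_recipDiff {S : Type*} [CommRing S] (f : R →+* S) (s t : ι → R) :
    f (recipDiff s t) = recipDiff (fun i => f (s i)) fun i => f (t i) := by
  simp only [recipDiff, map_sub, map_mul, map_prod, map_recipNum]

open scoped Ring in
theorem recipNum_eq_prod_mul_sum_inverse (hs : ∀ i, IsUnit (s i)) :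
    recipNum s = (∏ i, s i) * ∑ i, (s i)⁻¹ʳ := by
  rw [recipNum, mul_sum]
  refine sum_congr rfl fun i _ => ?_
  rw [← mul_prod_erase univ s (mem_univ i), mul_right_comm, Ring.mul_inverse_cancel _ (hs i),
    one_mul]

open scoped Ring in
theorem recipDiff_eq_zero_of_sum_inverse_eq (hs : ∀ i, IsUnit (s i)) (ht : ∀ i, IsUnit (t i))
    (h : ∑ i, (s i)⁻¹ʳ = ∑ i, (t i)⁻¹ʳ) : recipDiff s t = 0 := by
  rw [recipDiff, recipNum_eq_prod_mul_sum_inverse hs, recipNum_eq_prod_mul_sum_inverse ht, h]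
  ring

theorem dvd_prod_erase_of_dvd_recipNum {p : R} {i : ι} (hi : p ∣ s i) (h : p ∣ recipNum s) :
    p ∣ ∏ j ∈ univ.erase i, s j := by
  rw [recipNum, ← add_sum_erase univ _ (mem_univ i)] at h
  refine (dvd_add_left (dvd_sum fun j hj => ?_)).1 h
  exact hi.trans (dvd_prod_of_mem s (mem_erase.2 ⟨(ne_of_mem_erase hj).symm, mem_univ _⟩))

theorem sq_dvd_prod_mul_prod_of_recipDiff_eq_zero (h : recipDiff s t = 0) {p : R} (hp : Prime p)
    (hps : p ∣ ∏ i, s i) : p ^ 2 ∣ (∏ i, s i) * ∏ i, t i := by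
  by_cases hpt : p ∣ ∏ i, t i
  · rw [sq]
    exact mul_dvd_mul hps hpt
  have hnum : p ∣ recipNum s :=
    (hp.dvd_or_dvd (sub_eq_zero.1 h ▸ hps.mul_right _)).resolve_left hpt
  obtain ⟨i, -, hi⟩ := (hp.dvd_finsetProd_iff s).1 hps
  rw [sq, ← mul_prod_erase univ s (mem_univ i)]
  exact (mul_dvd_mul hi (dvd_prod_erase_of_dvd_recipNum hi hnum)).mul_right _

end

/-- `x` is powerful (squarefull): every prime dividing `x` divides it at least twice. -/
def IsPowerful {R : Type*} [CommMonoidWithZero R] (x : R) : Prop :=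
  ∀ p, Prime p → p ∣ x → p ^ 2 ∣ x

theorem isPowerful_of_recipDiff_eq_zero {ι R : Type*} [Fintype ι] [DecidableEq ι] [CommRing R]
    {s t : ι → R} (h : recipDiff s t = 0) : IsPowerful ((∏ i, s i) * ∏ i, t i) := by
  intro p hp hdvd
  rcases hp.dvd_or_dvd hdvd with hps | hpt
  · exact sq_dvd_prod_mul_prod_of_recipDiff_eq_zero h hp hps
  · rw [mul_comm]
    exact sq_dvd_prod_mul_prod_of_recipDiff_eq_zero (by rw [recipDiff_swap, h, neg_zero]) hp hpt

section

variable {R : Type*} [CommMonoidWithZero R] {x y : R}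

theorem IsPowerful.two_le_of_prime_pow [IsCancelMulZero R] {p : R} {i : ℕ} (hp : Prime p)
    (h : IsPowerful (p ^ i)) (hi : i ≠ 0) : 2 ≤ i :=
  (pow_dvd_pow_iff hp.ne_zero hp.not_isUnit).1 (h p hp (dvd_pow_self p hi))

theorem IsPowerful.of_mul_left [DecompositionMonoid R] (h : IsPowerful (x * y))
    (hxy : IsRelPrime x y) : IsPowerful x := fun p hp hpx =>
  (hxy.of_dvd_left hpx).pow_left.dvd_of_dvd_mul_right (h p hp (hpx.mul_right y))

theorem IsPowerful.exists_dvd_eq_sq_mul [UniqueFactorizationMonoid R]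
    (hx : x ≠ 0) (h : IsPowerful x) : ∃ a b, b ∣ a ∧ x = a ^ 2 * b := by
  induction x using UniqueFactorizationMonoid.induction_on_coprime with
  | h0 => exact absurd rfl hx
  | @h1 u hu => exact ⟨1, u, hu.dvd, by rw [one_pow, one_mul]⟩
  | @hpr p i hp =>
    refine ⟨p ^ (i / 2), p ^ (i % 2), pow_dvd_pow p ?_, ?_⟩
    · have := h.two_le_of_prime_pow hp
      omega
    · rw [← pow_mul, ← pow_add, Nat.div_add_mod']
  | @hcp x y hxy ihx ihy =>
    obtain ⟨a, b, hba, rfl⟩ := ihx (left_ne_zero_of_mul hx) (h.of_mul_left hxy)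
    obtain ⟨c, d, hdc, rfl⟩ :=
      ihy (right_ne_zero_of_mul hx) ((mul_comm _ y ▸ h).of_mul_left hxy.symm)
    exact ⟨a * c, b * d, mul_dvd_mul hba hdc, by rw [mul_pow, mul_mul_mul_comm]⟩

end

theorem exists_dvd_of_dvd_prod {ι R : Type*} [CommMonoidWithZero R] [DecompositionMonoid R]
    {T : Finset ι} {s : ι → R} {g : R} (h : g ∣ ∏ i ∈ T, s i) :
    ∃ f : ι → R, (∀ i, f i ∣ s i ∧ f i ∣ g) ∧ g ∣ ∏ i ∈ T, f i := by
  classical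
  induction T using Finset.induction_on generalizing g with
  | empty => exact ⟨fun _ => 1, fun i => ⟨one_dvd _, one_dvd _⟩, by simpa using h⟩
  | insert a T ha ih =>
    rw [prod_insert ha] at h
    obtain ⟨g₁, g₂, h1, h2, rfl⟩ := exists_dvd_and_dvd_of_dvd_mul h
    obtain ⟨f, hf, hgf⟩ := ih h2
    refine ⟨Function.update f a g₁, fun i => ?_, ?_⟩
    · rcases eq_or_ne i a with rfl | hi
      · simpa using h1
      · rw [Function.update_of_ne hi]
        exact ⟨(hf i).1, (hf i).2.mul_left _⟩
    · rw [prod_insert ha, Function.update_self, prod_update_of_notMem ha]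
      exact mul_dvd_mul_left _ hgf

theorem exists_eq_mul_dvd_forall_dvd_of_dvd_mul {R : Type*} [CommMonoidWithZero R] [GCDMonoid R]
    {x : R} (hx : x ≠ 0) (y : R) :
    ∃ g h, x = g * h ∧ g ∣ y ∧ ∀ z, x ∣ z * y → h ∣ z := by
  obtain ⟨h, hh⟩ := gcd_dvd_left x y
  refine ⟨gcd x y, h, hh, gcd_dvd_right x y, fun z hz => ?_⟩
  refine (mul_dvd_mul_iff_left fun h0 => hx ((gcd_eq_zero_iff x y).1 h0).1).1 ?_
  exact hh ▸ dvd_gcd_mul_of_dvd_mul (mul_comm z y ▸ hz)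

-- The witness `g` is the greatest common divisor of `∏ i, s i` and `recipNum s`.
theorem exists_prod_eq_mul_forall_dvd_sub {ι R : Type*} [Fintype ι] [DecidableEq ι] [CommRing R]
    [GCDMonoid R] {s : ι → R} (hs : ∏ i, s i ≠ 0) :
    ∃ g h, ∏ i, s i = g * h ∧ (∀ t, g ∣ recipDiff s t) ∧
      ∀ t t', recipDiff s t = recipDiff s t' → h ∣ ∏ i, t i - ∏ i, t' i := by
  obtain ⟨g, h, hgh, hg, hh⟩ := exists_eq_mul_dvd_forall_dvd_of_dvd_mul hs (recipNum s)
  refine ⟨g, h, hgh, fun t => ?_, fun t t' htt' => hh _ ⟨recipNum t - recipNum t', ?_⟩⟩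
  · exact dvd_sub (hg.mul_left _) ((Dvd.intro h hgh.symm).mul_right _)
  · simp only [recipDiff] at htt'
    linear_combination htt'

end Reciprocals

section Box

open Finset

variable {K : Type*} [Field K] [Finite K] {k n : ℕ} {s t : Fin k → K[X]} {x c g : K[X]}

variable (K) in
/-- The `k`-tuples of nonzero polynomials of degree less than `n`. -/
noncomputable def box (k n : ℕ) : Finset (Fin k → K[X]) :=
  Fintype.piFinset fun _ => nzLT K n

theorem mem_box : s ∈ box K k n ↔ ∀ i, s i ≠ 0 ∧ (s i).natDegree < n := by
  simp only [box, Fintype.mem_piFinset, mem_nzLT]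

theorem prod_ne_zero_of_mem_box (hs : s ∈ box K k n) : ∏ i, s i ≠ 0 :=
  prod_ne_zero_iff.2 fun i _ => (mem_box.1 hs i).1

theorem natDegree_prod_le_of_mem_box (hs : s ∈ box K k n) (T : Finset (Fin k)) :
    (∏ i ∈ T, s i).natDegree ≤ #T * (n - 1) := by
  refine (natDegree_prod_le _ _).trans (sum_le_card_nsmul _ _ _ fun i _ => ?_)
  have := (mem_box.1 hs i).2
  omega

theorem natDegree_prod_univ_le_of_mem_box (hs : s ∈ box K k n) :
    (∏ i, s i).natDegree ≤ k * (n - 1) := by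
  simpa using natDegree_prod_le_of_mem_box hs univ

theorem natDegree_recipNum_le (hs : s ∈ box K k n) :
    (recipNum s).natDegree ≤ (k - 1) * (n - 1) := by
  refine natDegree_sum_le_of_forall_le _ _ fun i _ => ?_
  simpa [card_erase_of_mem] using natDegree_prod_le_of_mem_box hs (univ.erase i)

theorem natDegree_recipDiff_le (hs : s ∈ box K k n) (ht : t ∈ box K k n) :
    (recipDiff s t).natDegree ≤ (2 * k - 1) * (n - 1) := by
  have hsplit : k * (n - 1) + (k - 1) * (n - 1) = (2 * k - 1) * (n - 1) := by
    rw [← add_mul]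
    congr 1
    omega
  rw [← hsplit]
  refine (natDegree_sub_le _ _).trans (max_le ?_ ?_)
  · exact natDegree_mul_le_of_le (natDegree_prod_univ_le_of_mem_box ht) (natDegree_recipNum_le hs)
  · exact natDegree_mul_le_of_le (natDegree_prod_univ_le_of_mem_box hs) (natDegree_recipNum_le ht)

open Classical in
theorem card_box_filter_prod_eq_le (hx : x ≠ 0) :
    #{s ∈ box K k n | ∏ i, s i = x} ≤ #(divs x) ^ k := by
  rw [← Fintype.card_piFinset_const]
  refine card_le_card fun s hs => Fintype.mem_piFinset.2 fun i => ?_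
  rw [mem_divs hx, ← (mem_filter.1 hs).2]
  exact dvd_prod_of_mem _ (mem_univ i)

open Classical in
theorem card_piFinset_filter_dvd_mul_le {f : Fin k → K[X]} (hg : g ≠ 0) (hf : ∀ i, f i ∣ g)
    (hgf : g ∣ ∏ i, f i) :
    #(Fintype.piFinset fun i => {x ∈ nzLT K n | f i ∣ x}) * Nat.card K ^ g.natDegree ≤
      Nat.card K ^ (k * n) := by
  have hf0 (i) : f i ≠ 0 := ne_zero_of_dvd_ne_zero hg (hf i)
  have hdeg : g.natDegree ≤ ∑ i, (f i).natDegree := by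
    rw [← natDegree_prod _ _ fun i _ => hf0 i]
    exact natDegree_le_of_dvd hgf (prod_ne_zero_iff.2 fun i _ => hf0 i)
  calc
    _ ≤ (∏ i, #{x ∈ nzLT K n | f i ∣ x}) * ∏ i, Nat.card K ^ (f i).natDegree := by
      rw [Fintype.card_piFinset, prod_pow_eq_pow_sum]
      gcongr
      exact Nat.card_pos
    _ ≤ ∏ _i : Fin k, Nat.card K ^ n := by
      rw [← prod_mul_distrib]
      exact prod_le_prod' fun i _ => card_nzLT_filter_dvd_mul_le n (hf0 i)
    _ = Nat.card K ^ (k * n) := by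
      rw [prod_const, card_univ, Fintype.card_fin, ← pow_mul, mul_comm]

open Classical in
theorem card_box_filter_dvd_prod_mul_le (hg : g ≠ 0) :
    #{s ∈ box K k n | g ∣ ∏ i, s i} * Nat.card K ^ g.natDegree ≤
      #(divs g) ^ k * Nat.card K ^ (k * n) := by
  let Φ : Finset (Fin k → K[X]) := {f ∈ Fintype.piFinset fun _ => divs g | g ∣ ∏ i, f i}
  have mem_Φ {f} : f ∈ Φ ↔ (∀ i, f i ∣ g) ∧ g ∣ ∏ i, f i := by
    simp only [Φ, mem_filter, Fintype.mem_piFinset, mem_divs hg]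
  have hsub : {s ∈ box K k n | g ∣ ∏ i, s i} ⊆
      Φ.biUnion fun f => Fintype.piFinset fun i => {x ∈ nzLT K n | f i ∣ x} := by
    intro s hs
    obtain ⟨hs, hgs⟩ := mem_filter.1 hs
    obtain ⟨f, hf, hgf⟩ := exists_dvd_of_dvd_prod hgs
    exact mem_biUnion.2 ⟨f, mem_Φ.2 ⟨fun i => (hf i).2, hgf⟩, Fintype.mem_piFinset.2 fun i =>
      mem_filter.2 ⟨Fintype.mem_piFinset.1 hs i, (hf i).1⟩⟩
  have hΦ : #Φ ≤ #(divs g) ^ k :=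
    (card_filter_le _ _).trans_eq (Fintype.card_piFinset_const _ _)
  calc
    _ ≤ (∑ f ∈ Φ, #(Fintype.piFinset fun i => {x ∈ nzLT K n | f i ∣ x})) *
        Nat.card K ^ g.natDegree := by
      gcongr
      exact (card_le_card hsub).trans card_biUnion_le
    _ ≤ #Φ * Nat.card K ^ (k * n) := by
      rw [sum_mul, ← smul_eq_mul]
      exact sum_le_card_nsmul _ _ _ fun f hf =>
        card_piFinset_filter_dvd_mul_le hg (mem_Φ.1 hf).1 (mem_Φ.1 hf).2
    _ ≤ _ := by gcongr

end Box

section ReciprocalEnergy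

open Finset

variable {K : Type*} [Field K] [Finite K] {k n : ℕ} {s t : Fin k → K[X]} {x c : K[X]}

open Classical in
theorem card_filter_isPowerful_le (N : ℕ) :
    #{x ∈ nzLT K (2 * N) | IsPowerful x} ≤ maxDivs K N * Nat.card K ^ N := by
  have hsub : {x ∈ nzLT K (2 * N) | IsPowerful x} ⊆
      (nzLT K N).biUnion fun a => (divs a).image fun b => a ^ 2 * b := by
    intro x hx
    rw [mem_filter, mem_nzLT] at hx
    obtain ⟨⟨hx0, hdeg⟩, hx⟩ := hx
    obtain ⟨a, b, hba, rfl⟩ := hx.exists_dvd_eq_sq_mul hx0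
    obtain ⟨ha0, hb0⟩ := mul_ne_zero_iff.1 hx0
    rw [natDegree_mul ha0 hb0, natDegree_pow] at hdeg
    have ha : a ≠ 0 := ne_zero_pow two_ne_zero ha0
    exact mem_biUnion.2 ⟨a, mem_nzLT.2 ⟨ha, by omega⟩,
      mem_image_of_mem _ ((mem_divs ha).2 hba)⟩
  calc
    _ ≤ ∑ a ∈ nzLT K N, #((divs a).image fun b => a ^ 2 * b) :=
      (card_le_card hsub).trans card_biUnion_le
    _ ≤ #(nzLT K N) * maxDivs K N := by
      refine sum_le_card_nsmul _ _ _ fun a ha => card_image_le.trans ?_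
      exact card_divs_le_maxDivs (mem_nzLT.1 ha).1 (mem_nzLT.1 ha).2.le
    _ ≤ maxDivs K N * Nat.card K ^ N := by
      rw [mul_comm]
      gcongr
      exact card_nzLT_le K N

open Classical in
/-- The pairs of tuples whose sums of reciprocals differ by `c / ((∏ i, s i) * ∏ i, t i)`. -/
noncomputable def diffPairs (K : Type*) [Field K] [Finite K] (k n : ℕ) (c : K[X]) :
    Finset ((Fin k → K[X]) × (Fin k → K[X])) :=
  {p ∈ box K k n ×ˢ box K k n | recipDiff p.1 p.2 = c}

theorem mem_diffPairs {p : (Fin k → K[X]) × (Fin k → K[X])} :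
    p ∈ diffPairs K k n c ↔ (p.1 ∈ box K k n ∧ p.2 ∈ box K k n) ∧ recipDiff p.1 p.2 = c := by
  classical
  rw [diffPairs, mem_filter, mem_product]

open Classical in
theorem card_box_product_filter_prod_mul_prod_eq_le (hx : x ≠ 0) :
    #{p ∈ box K k n ×ˢ box K k n | (∏ i, p.1 i) * ∏ i, p.2 i = x} ≤ #(divs x) ^ (2 * k) := by
  rw [two_mul, pow_add, ← Fintype.card_piFinset_const, ← card_product]
  refine card_le_card fun p hp => ?_
  obtain ⟨-, rfl⟩ := mem_filter.1 hp
  simp only [mem_product, Fintype.mem_piFinset, mem_divs hx]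
  exact ⟨fun i => (dvd_prod_of_mem _ (mem_univ i)).mul_right _,
    fun i => (dvd_prod_of_mem _ (mem_univ i)).mul_left _⟩

theorem card_diffPairs_zero_le (hk : 0 < k) (hn : 0 < n) :
    #(diffPairs K k n 0) ≤ maxDivs K (2 * k * n) ^ (2 * k + 1) * Nat.card K ^ (k * n) := by
  classical
  have hlt : k * (n - 1) < k * n := Nat.mul_lt_mul_of_pos_left (Nat.sub_lt hn one_pos) hk
  have hmaps (p) (hp : p ∈ diffPairs K k n 0) :
      (∏ i, p.1 i) * ∏ i, p.2 i ∈ ({x ∈ nzLT K (2 * (k * n)) | IsPowerful x} : Finset K[X]) := by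
    obtain ⟨⟨hs, ht⟩, h⟩ := mem_diffPairs.1 hp
    refine mem_filter.2 ⟨mem_nzLT.2 ⟨mul_ne_zero (prod_ne_zero_of_mem_box hs)
      (prod_ne_zero_of_mem_box ht), ?_⟩, isPowerful_of_recipDiff_eq_zero h⟩
    have := natDegree_mul_le_of_le (natDegree_prod_univ_le_of_mem_box hs)
      (natDegree_prod_univ_le_of_mem_box ht)
    omega
  have hfib (x) (hx : x ∈ ({x ∈ nzLT K (2 * (k * n)) | IsPowerful x} : Finset K[X])) :
      #{p ∈ diffPairs K k n 0 | (∏ i, p.1 i) * ∏ i, p.2 i = x} ≤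
        maxDivs K (2 * k * n) ^ (2 * k) := by
    obtain ⟨hx0, hdeg⟩ := mem_nzLT.1 (mem_filter.1 hx).1
    refine (card_le_card (filter_subset_filter _ (filter_subset _ _))).trans
      ((card_box_product_filter_prod_mul_prod_eq_le hx0).trans ?_)
    gcongr
    exact card_divs_le_maxDivs hx0 (mul_assoc 2 k n ▸ hdeg.le)
  calc
    _ ≤ maxDivs K (2 * k * n) ^ (2 * k) * #{x ∈ nzLT K (2 * (k * n)) | IsPowerful x} :=
      card_le_mul_card_image_of_maps_to hmaps _ hfib
    _ ≤ maxDivs K (2 * k * n) ^ (2 * k) * (maxDivs K (2 * k * n) * Nat.card K ^ (k * n)) := by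
      gcongr
      refine (card_filter_isPowerful_le _).trans ?_
      gcongr
      exact maxDivs_mono (by rw [mul_assoc]; omega)
    _ = _ := by ring

open Classical in
theorem card_filter_prod_dvd_sub_le {h w : K[X]} (hh : h ≠ 0) {d : ℕ} (hd : d ≤ 2 * k * n) :
    #{t ∈ box K k n | (∏ i, t i).natDegree ≤ d ∧ h ∣ ∏ i, t i - w} ≤
      maxDivs K (2 * k * n) ^ k * Nat.card K ^ (d + 1 - h.natDegree) := by
  have hmaps (t) (ht : t ∈ ({t ∈ box K k n | (∏ i, t i).natDegree ≤ d ∧ h ∣ ∏ i, t i - w} :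
      Finset (Fin k → K[X]))) :
      ∏ i, t i ∈ ({x ∈ nzLT K (d + 1) | h ∣ x - w} : Finset K[X]) := by
    obtain ⟨ht, htd, hth⟩ := mem_filter.1 ht
    exact mem_filter.2 ⟨mem_nzLT.2 ⟨prod_ne_zero_of_mem_box ht, Nat.lt_succ_of_le htd⟩, hth⟩
  refine (card_le_mul_card_image_of_maps_to hmaps (maxDivs K (2 * k * n) ^ k)
    fun x hx => ?_).trans ?_
  · obtain ⟨hx0, hxd⟩ := mem_nzLT.1 (mem_filter.1 hx).1
    refine (card_le_card (filter_subset_filter _ (filter_subset _ _))).trans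
      ((card_box_filter_prod_eq_le hx0).trans ?_)
    gcongr
    exact card_divs_le_maxDivs hx0 (by omega)
  · gcongr
    refine (card_le_card (filter_subset_filter _ ?_)).trans
      (card_polysLT_filter_dvd_sub_le (d + 1) hh w)
    exact fun x => mem_of_mem_erase

open Classical in
theorem exists_dvd_card_filter_recipDiff_eq_le (c : K[X]) (hs : s ∈ box K k n) :
    ∃ g, g ∣ c ∧ g ∣ ∏ i, s i ∧
      #{t ∈ box K k n | recipDiff s t = c ∧ (∏ i, t i).natDegree ≤ (∏ i, s i).natDegree} ≤
        maxDivs K (2 * k * n) ^ k * Nat.card K ^ (g.natDegree + 1) := by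
  rcases eq_empty_or_nonempty {t ∈ box K k n |
    recipDiff s t = c ∧ (∏ i, t i).natDegree ≤ (∏ i, s i).natDegree} with h | ⟨t₀, ht₀⟩
  · exact ⟨1, one_dvd _, one_dvd _, by simp only [h, card_empty, Nat.zero_le]⟩
  obtain ⟨-, hc, -⟩ := mem_filter.1 ht₀
  have hs0 := prod_ne_zero_of_mem_box hs
  let := EuclideanDomain.gcdMonoid K[X]
  obtain ⟨g, h, hgh, hg, hdvd⟩ := exists_prod_eq_mul_forall_dvd_sub hs0
  obtain ⟨hg0, hh0⟩ := mul_ne_zero_iff.1 (hgh ▸ hs0)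
  refine ⟨g, hc ▸ hg t₀, Dvd.intro h hgh.symm, ?_⟩
  have hdeg : (∏ i, s i).natDegree = g.natDegree + h.natDegree := by
    rw [hgh, natDegree_mul hg0 hh0]
  have hle : (∏ i, s i).natDegree ≤ 2 * k * n := (natDegree_prod_univ_le_of_mem_box hs).trans
    (Nat.mul_le_mul (by omega) (Nat.sub_le n 1))
  refine (card_le_card fun t ht => ?_).trans
    ((card_filter_prod_dvd_sub_le (w := ∏ i, t₀ i) hh0 hle).trans_eq ?_)
  · obtain ⟨ht, hct, htd⟩ := mem_filter.1 ht
    exact mem_filter.2 ⟨ht, htd, hdvd t t₀ (hct.trans hc.symm)⟩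
  · congr 2
    omega

open Classical in
theorem card_diffPairs_filter_natDegree_le (hc : c ≠ 0) (hdeg : c.natDegree ≤ 2 * k * n) :
    #{p ∈ diffPairs K k n c | (∏ i, p.2 i).natDegree ≤ (∏ i, p.1 i).natDegree} ≤
      Nat.card K * maxDivs K (2 * k * n) ^ (2 * k + 1) * Nat.card K ^ (k * n) := by
  set D := maxDivs K (2 * k * n)
  have hfib (s) (hs : s ∈ box K k n) :
      #{t ∈ box K k n | recipDiff s t = c ∧ (∏ i, t i).natDegree ≤ (∏ i, s i).natDegree} ≤
        ∑ g ∈ divs c, if g ∣ ∏ i, s i then D ^ k * Nat.card K ^ (g.natDegree + 1) else 0 := by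
    obtain ⟨g, hgc, hgs, h⟩ := exists_dvd_card_filter_recipDiff_eq_le c hs
    refine h.trans ?_
    rw [← sum_filter]
    exact single_le_sum (f := fun g : K[X] => D ^ k * Nat.card K ^ (g.natDegree + 1))
      (fun _ _ => Nat.zero_le _) (mem_filter.2 ⟨(mem_divs hc).2 hgc, hgs⟩)
  have hterm (g) (hg : g ∈ divs c) :
      #{s ∈ box K k n | g ∣ ∏ i, s i} * (D ^ k * Nat.card K ^ (g.natDegree + 1)) ≤
        D ^ k * Nat.card K ^ (k * n) * (D ^ k * Nat.card K) := by
    have hgc := (mem_divs hc).1 hg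
    have hg0 := ne_zero_of_dvd_ne_zero hc hgc
    calc
      _ = #{s ∈ box K k n | g ∣ ∏ i, s i} * Nat.card K ^ g.natDegree * (D ^ k * Nat.card K) := by
        ring
      _ ≤ #(divs g) ^ k * Nat.card K ^ (k * n) * (D ^ k * Nat.card K) :=
        Nat.mul_le_mul_right _ (card_box_filter_dvd_prod_mul_le hg0)
      _ ≤ _ := by
        gcongr
        exact card_divs_le_maxDivs hg0 ((natDegree_le_of_dvd hgc hc).trans hdeg)
  calc
    _ = ∑ s ∈ box K k n,
        #{t ∈ box K k n | recipDiff s t = c ∧ (∏ i, t i).natDegree ≤ (∏ i, s i).natDegree} := by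
      simp only [diffPairs, filter_filter, card_filter, sum_product]
    _ ≤ ∑ s ∈ box K k n, ∑ g ∈ divs c,
        if g ∣ ∏ i, s i then D ^ k * Nat.card K ^ (g.natDegree + 1) else 0 := sum_le_sum hfib
    _ = ∑ g ∈ divs c, #{s ∈ box K k n | g ∣ ∏ i, s i} *
        (D ^ k * Nat.card K ^ (g.natDegree + 1)) := by
      rw [sum_comm]
      simp only [← sum_filter, sum_const, smul_eq_mul]
    _ ≤ #(divs c) * (D ^ k * Nat.card K ^ (k * n) * (D ^ k * Nat.card K)) :=
      sum_le_card_nsmul _ _ _ hterm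
    _ ≤ D * (D ^ k * Nat.card K ^ (k * n) * (D ^ k * Nat.card K)) := by
      gcongr
      exact card_divs_le_maxDivs hc hdeg
    _ = _ := by ring

theorem card_diffPairs_le (hc : c ≠ 0) (hdeg : c.natDegree ≤ 2 * k * n) :
    #(diffPairs K k n c) ≤
      2 * (Nat.card K * maxDivs K (2 * k * n) ^ (2 * k + 1) * Nat.card K ^ (k * n)) := by
  classical
  rw [← card_filter_add_card_filter_not
    (fun p => (∏ i, p.2 i).natDegree ≤ (∏ i, p.1 i).natDegree), two_mul]
  refine Nat.add_le_add (card_diffPairs_filter_natDegree_le hc hdeg) ?_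
  refine (card_le_card_of_injOn Prod.swap (fun p hp => ?_) Prod.swap_injective.injOn).trans
    (card_diffPairs_filter_natDegree_le (neg_ne_zero.2 hc) (by rwa [natDegree_neg]))
  obtain ⟨hp, hlt⟩ := mem_filter.1 hp
  obtain ⟨⟨hs, ht⟩, h⟩ := mem_diffPairs.1 hp
  exact mem_filter.2 ⟨mem_diffPairs.2 ⟨⟨ht, hs⟩, (recipDiff_swap _ _).trans (congrArg _ h)⟩,
    (not_le.1 hlt).le⟩

theorem card_diffPairs_le_of_natDegree_le (hk : 0 < k) (hn : 0 < n)
    (hdeg : c.natDegree ≤ 2 * k * n) :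
    #(diffPairs K k n c) ≤
      2 * (Nat.card K * maxDivs K (2 * k * n) ^ (2 * k + 1) * Nat.card K ^ (k * n)) := by
  rcases eq_or_ne c 0 with rfl | hc
  · exact (card_diffPairs_zero_le hk hn).trans ((Nat.le_mul_of_pos_left _
      (mul_pos two_pos (Nat.card_pos (α := K)))).trans_eq (by ring))
  · exact card_diffPairs_le hc hdeg

open scoped Ring in
theorem exists_recipDiff_eq_mul {F : K[X]} (hF : F ≠ 0) (hn : 0 < n) (hk : 0 < k)
    (hs : s ∈ box K k n) (ht : t ∈ box K k n) (hsF : ∀ i, IsCoprime (s i) F)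
    (htF : ∀ i, IsCoprime (t i) F)
    (h : ∑ i, (AdjoinRoot.mk F (s i))⁻¹ʳ = ∑ i, (AdjoinRoot.mk F (t i))⁻¹ʳ) :
    ∃ c ∈ polysLT K ((2 * k - 1) * n - F.natDegree), recipDiff s t = F * c := by
  have hdvd : F ∣ recipDiff s t := by
    rw [← AdjoinRoot.mk_eq_zero, map_recipDiff]
    exact recipDiff_eq_zero_of_sum_inverse_eq (fun i => isUnit_mk_iff.2 (hsF i))
      (fun i => isUnit_mk_iff.2 (htF i)) h
  obtain ⟨c, hc⟩ := hdvd
  refine ⟨c, ?_, hc⟩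
  rcases eq_or_ne c 0 with rfl | hc0
  · rw [mem_polysLT, degree_zero]
    exact WithBot.bot_lt_coe _
  · have hdeg := natDegree_recipDiff_le hs ht
    have hlt : (2 * k - 1) * (n - 1) < (2 * k - 1) * n :=
      Nat.mul_lt_mul_of_pos_left (Nat.sub_lt hn one_pos) (by omega)
    rw [hc, natDegree_mul hF hc0] at hdeg
    rw [mem_polysLT_of_ne_zero hc0]
    omega

open scoped Ring in
theorem energy_inverse_le {F : K[X]} (hF0 : F ≠ 0) (hF : ¬ IsUnit F) (hk : 0 < k) (hn : 0 < n) :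
    energy (coprimeLT F n) (fun x => (AdjoinRoot.mk F x)⁻¹ʳ) k ≤
      2 * Nat.card K * maxDivs K (2 * k * n) ^ (2 * k + 1) *
        Nat.card K ^ (k * n + ((2 * k - 1) * n - F.natDegree)) := by
  classical
  set N := (2 * k - 1) * n - F.natDegree
  have hsub : energy (coprimeLT F n) (fun x => (AdjoinRoot.mk F x)⁻¹ʳ) k ≤
      #((polysLT K N).biUnion fun c => diffPairs K k n (F * c)) := by
    refine card_le_card fun p hp => ?_
    simp only [mem_filter, mem_product, Fintype.mem_piFinset] at hp
    obtain ⟨⟨hs, ht⟩, h⟩ := hp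
    have mem_box_of {s : Fin k → K[X]} (hs : ∀ i, s i ∈ coprimeLT F n) : s ∈ box K k n :=
      Fintype.mem_piFinset.2 fun i => coprimeLT_subset_nzLT hF (hs i)
    obtain ⟨c, hc, hpc⟩ := exists_recipDiff_eq_mul hF0 hn hk (mem_box_of hs) (mem_box_of ht)
      (fun i => (mem_coprimeLT.1 (hs i)).2) (fun i => (mem_coprimeLT.1 (ht i)).2) h
    exact mem_biUnion.2 ⟨c, hc, mem_diffPairs.2 ⟨⟨mem_box_of hs, mem_box_of ht⟩, hpc⟩⟩
  have hdeg (c) (hc : c ∈ polysLT K N) : (F * c).natDegree ≤ 2 * k * n := by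
    rcases eq_or_ne c 0 with rfl | hc0
    · simp
    · rw [mem_polysLT_of_ne_zero hc0] at hc
      have : (2 * k - 1) * n ≤ 2 * k * n := Nat.mul_le_mul_right n (Nat.sub_le _ 1)
      rw [natDegree_mul hF0 hc0]
      omega
  calc
    _ ≤ ∑ c ∈ polysLT K N, #(diffPairs K k n (F * c)) := hsub.trans card_biUnion_le
    _ ≤ #(polysLT K N) * (2 * (Nat.card K * maxDivs K (2 * k * n) ^ (2 * k + 1) *
        Nat.card K ^ (k * n))) :=
      sum_le_card_nsmul _ _ _ fun c hc =>
        card_diffPairs_le_of_natDegree_le hk hn (hdeg c hc)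
    _ = _ := by
      rw [card_polysLT, pow_add]
      ring

end ReciprocalEnergy

section SecondEnergy

open Finset

/-- Dirichlet's approximation theorem modulo `F`. -/
theorem exists_mk_mul_eq_mk {K : Type*} [Field K] {F : K[X]} (hF : F ≠ 0) (y : AdjoinRoot F)
    {a b : ℕ} (hb : b ≤ F.natDegree) (hab : F.natDegree < a + b) :
    ∃ v u : K[X], v ≠ 0 ∧ v.degree < a ∧ u.degree < b ∧
      AdjoinRoot.mk F v * y = AdjoinRoot.mk F u := by
  let mkL : K[X] →ₗ[K] AdjoinRoot F := (AdjoinRoot.mkₐ F).toLinearMap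
  let f : degreeLT K a × degreeLT K b →ₗ[K] AdjoinRoot F :=
    ((LinearMap.mulRight K y ∘ₗ mkL) ∘ₗ (degreeLT K a).subtype).coprod
      (-(mkL ∘ₗ (degreeLT K b).subtype))
  have := (AdjoinRoot.powerBasis hF).finite
  have finrank_degreeLT (n : ℕ) : Module.finrank K (degreeLT K n) = n := by
    rw [(degreeLTEquiv K n).finrank_eq, Module.finrank_fin_fun]
  have hfinrank : Module.finrank K (AdjoinRoot F) <
      Module.finrank K (degreeLT K a × degreeLT K b) := by
    rwa [(AdjoinRoot.powerBasis hF).finrank, AdjoinRoot.powerBasis_dim, Module.finrank_prod,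
      finrank_degreeLT, finrank_degreeLT]
  obtain ⟨⟨⟨v, hv⟩, u, hu⟩, hker, hne⟩ :=
    Submodule.exists_mem_ne_zero_of_ne_bot (LinearMap.ker_ne_bot_of_finrank_lt hfinrank (f := f))
  rw [mem_degreeLT] at hv hu
  have hvu : AdjoinRoot.mk F v * y = AdjoinRoot.mk F u := by
    have : AdjoinRoot.mk F v * y + -AdjoinRoot.mk F u = 0 := hker
    rwa [← sub_eq_add_neg, sub_eq_zero] at this
  refine ⟨v, u, ?_, hv, hu, hvu⟩
  rintro rfl
  rw [map_zero, zero_mul, eq_comm, AdjoinRoot.mk_eq_zero] at hvu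
  have hu0 : u = 0 := eq_zero_of_dvd_of_degree_lt hvu
    (hu.trans_le ((Nat.cast_le.2 hb).trans_eq (degree_eq_natDegree hF).symm))
  exact hne (by simp [hu0])

section

open scoped Ring

variable {R : Type*} [CommRing R] {x z u v : R}

theorem mul_mul_inverse_add_inverse (hx : IsUnit x) (hz : IsUnit z) :
    x * z * (x⁻¹ʳ + z⁻¹ʳ) = x + z := by
  linear_combination z * Ring.mul_inverse_cancel x hx + x * Ring.mul_inverse_cancel z hz

theorem mul_mul_eq_mul_add_of_mul_inverse_add_inverse_eq (hx : IsUnit x) (hz : IsUnit z)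
    (h : v * (x⁻¹ʳ + z⁻¹ʳ) = u) : u * x * z = v * (x + z) := by
  rw [← h, ← mul_mul_inverse_add_inverse hx hz]
  ring

theorem eq_zero_of_mul_eq (hx : IsUnit x) (hz : IsUnit z) (h : v * (x⁻¹ʳ + z⁻¹ʳ) = u)
    (hux : u * x = v) : u = 0 := by
  have hvx : v * x = 0 := by
    linear_combination z * hux - mul_mul_eq_mul_add_of_mul_inverse_add_inverse_eq hx hz h
  have hv : v = 0 := hx.mul_left_eq_zero.1 hvx
  rw [← h, hv, zero_mul]

end

variable {K : Type*} [Field K] [Finite K] {F u v x z w : K[X]} {m : ℕ}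

open scoped Ring

open Classical in
theorem card_filter_mul_sub_mul_mul_sub_eq_le (S : Finset (Fin 2 → K[X])) (hu : u ≠ 0)
    (hw : w ≠ 0) : #{s ∈ S | (u * s 0 - v) * (u * s 1 - v) = w} ≤ #(divs w) := by
  refine card_le_card_of_injOn (fun s => u * s 0 - v)
    (fun s hs => (mem_divs hw).2 (Dvd.intro _ (mem_filter.1 hs).2))
    fun s hs s' hs' (h0 : u * s 0 - v = u * s' 0 - v) => ?_
  have hsw := (mem_filter.1 hs).2
  have h1 : u * s 1 - v = u * s' 1 - v := by
    refine mul_left_cancel₀ (left_ne_zero_of_mul (hsw ▸ hw)) (hsw.trans ?_)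
    rw [h0, (mem_filter.1 hs').2]
  exact funext (Fin.forall_fin_two.2 ⟨mul_left_cancel₀ hu (sub_left_injective h0),
    mul_left_cancel₀ hu (sub_left_injective h1)⟩)

theorem mul_mul_sub_mul_add_mem_polysLT (hx : x ∈ nzLT K m) (hz : z ∈ nzLT K m)
    {d : ℕ} (hv : v.natDegree ≤ (m + d) / 2) (hu : u.natDegree < d - (m + d) / 2) :
    u * x * z - v * (x + z) ∈ polysLT K (d + (3 * m + 1 - d) / 2) := by
  have hx := (mem_nzLT.1 hx).2
  have hz := (mem_nzLT.1 hz).2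
  have huxz : (u * x * z).natDegree ≤ u.natDegree + x.natDegree + z.natDegree :=
    natDegree_mul_le_of_le natDegree_mul_le le_rfl
  have hvxz : (v * (x + z)).natDegree ≤ v.natDegree + max x.natDegree z.natDegree :=
    natDegree_mul_le_of_le le_rfl (natDegree_add_le _ _)
  have hsub := natDegree_sub_le (u * x * z) (v * (x + z))
  rcases eq_or_ne (u * x * z - v * (x + z)) 0 with h | h
  · rw [h, mem_polysLT, degree_zero]
    exact WithBot.bot_lt_coe _
  · rw [mem_polysLT_of_ne_zero h]
    omega

theorem natDegree_mul_sub_le_two_mul (hx : x ∈ nzLT K m) {d : ℕ} (hm : m ≤ d)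
    (hv : v.natDegree ≤ (m + d) / 2) (hu : u.natDegree < d - (m + d) / 2) :
    (u * x - v).natDegree ≤ 2 * d := by
  have hx := (mem_nzLT.1 hx).2
  have hux : (u * x).natDegree ≤ u.natDegree + x.natDegree := natDegree_mul_le
  have hsub := natDegree_sub_le (u * x) v
  omega

-- If `u x z - v (x + z) = c` then `(u x - v) (u z - v) = v² + u c`, so `c` determines `x` and `z`
-- up to the choice of a divisor.
open Classical in
theorem card_filter_mul_mul_sub_mul_add_eq_le (S : Finset (Fin 2 → K[X]))
    (hS : ∀ s ∈ S, ∀ i, s i ∈ nzLT K m ∧ u * s i - v ≠ 0) (hu0 : u ≠ 0) {d : ℕ} (hm : m ≤ d)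
    (hv : v.natDegree ≤ (m + d) / 2) (hu : u.natDegree < d - (m + d) / 2) (c : K[X]) :
    #{s ∈ S | u * s 0 * s 1 - v * (s 0 + s 1) = c} ≤ maxDivs K (4 * d) := by
  have hfactor (s : Fin 2 → K[X]) (hs : u * s 0 * s 1 - v * (s 0 + s 1) = c) :
      (u * s 0 - v) * (u * s 1 - v) = v ^ 2 + u * c := by
    linear_combination u * hs
  rcases eq_empty_or_nonempty {s ∈ S | u * s 0 * s 1 - v * (s 0 + s 1) = c} with h | ⟨t, ht⟩
  · rw [h, card_empty]
    exact Nat.zero_le _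
  obtain ⟨htS, htc⟩ := mem_filter.1 ht
  have hw : v ^ 2 + u * c ≠ 0 := by
    rw [← hfactor t htc]
    exact mul_ne_zero (hS t htS 0).2 (hS t htS 1).2
  have hdeg : (v ^ 2 + u * c).natDegree ≤ 4 * d := by
    rw [← hfactor t htc]
    refine (natDegree_mul_le_of_le (natDegree_mul_sub_le_two_mul (hS t htS 0).1 hm hv hu)
      (natDegree_mul_sub_le_two_mul (hS t htS 1).1 hm hv hu)).trans ?_
    omega
  calc
    _ ≤ #{s ∈ S | (u * s 0 - v) * (u * s 1 - v) = v ^ 2 + u * c} :=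
      card_le_card (monotone_filter_right S fun s _ hs => hfactor s hs)
    _ ≤ #(divs (v ^ 2 + u * c)) := card_filter_mul_sub_mul_mul_sub_eq_le S hu0 hw
    _ ≤ _ := card_divs_le_maxDivs hw hdeg

theorem card_sumReps_inverse_two_le (hF : ¬ IsUnit F) (hm : m ≤ F.natDegree) {y : AdjoinRoot F}
    (hu0 : u ≠ 0) (hv : v.natDegree ≤ (m + F.natDegree) / 2)
    (hu : u.natDegree < F.natDegree - (m + F.natDegree) / 2)
    (hvu : AdjoinRoot.mk F v * y = AdjoinRoot.mk F u) :
    #(sumReps (coprimeLT F m) (fun x => (AdjoinRoot.mk F x)⁻¹ʳ) 2 y) ≤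
      maxDivs K (4 * F.natDegree) * Nat.card K ^ ((3 * m + 1 - F.natDegree) / 2) := by
  classical
  set S := sumReps (coprimeLT F m) (fun x => (AdjoinRoot.mk F x)⁻¹ʳ) 2 y
  have hF0 : F ≠ 0 := by
    rintro rfl
    simp at hu
  have mk_u_ne_zero : AdjoinRoot.mk F u ≠ 0 := fun h =>
    absurd (natDegree_le_of_dvd (AdjoinRoot.mk_eq_zero.1 h) hu0) (by omega)
  have isUnit_mk (s) (hs : s ∈ S) (i) : IsUnit (AdjoinRoot.mk F (s i)) :=
    isUnit_mk_iff.2 (mem_coprimeLT.1 ((mem_sumReps.1 hs).1 i)).2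
  have mk_eq (s) (hs : s ∈ S) : AdjoinRoot.mk F v *
      ((AdjoinRoot.mk F (s 0))⁻¹ʳ + (AdjoinRoot.mk F (s 1))⁻¹ʳ) = AdjoinRoot.mk F u := by
    rw [← hvu, ← (mem_sumReps.1 hs).2, Fin.sum_univ_two]
  have mem_nzLT_of_mem (s) (hs : s ∈ S) (i) : s i ∈ nzLT K m :=
    coprimeLT_subset_nzLT hF ((mem_sumReps.1 hs).1 i)
  have mul_sub_ne_zero (s) (hs : s ∈ S) : ∀ i, u * s i - v ≠ 0 := by
    refine Fin.forall_fin_two.2 ⟨fun h => mk_u_ne_zero ?_, fun h => mk_u_ne_zero ?_⟩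
    · exact eq_zero_of_mul_eq (isUnit_mk s hs 0) (isUnit_mk s hs 1) (mk_eq s hs)
        (by rw [← map_mul, sub_eq_zero.1 h])
    · exact eq_zero_of_mul_eq (isUnit_mk s hs 1) (isUnit_mk s hs 0)
        (by rw [add_comm, mk_eq s hs]) (by rw [← map_mul, sub_eq_zero.1 h])
  have hmaps (s) (hs : s ∈ S) : u * s 0 * s 1 - v * (s 0 + s 1) ∈
      ({c ∈ polysLT K (F.natDegree + (3 * m + 1 - F.natDegree) / 2) | F ∣ c - 0} :
        Finset K[X]) := by
    refine mem_filter.2 ⟨mul_mul_sub_mul_add_mem_polysLT (mem_nzLT_of_mem s hs 0)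
      (mem_nzLT_of_mem s hs 1) hv hu, ?_⟩
    rw [sub_zero, ← AdjoinRoot.mk_eq_mk]
    simpa only [map_mul, map_add] using mul_mul_eq_mul_add_of_mul_inverse_add_inverse_eq
      (isUnit_mk s hs 0) (isUnit_mk s hs 1) (mk_eq s hs)
  refine (card_le_mul_card_image_of_maps_to hmaps _ fun c _ =>
    card_filter_mul_mul_sub_mul_add_eq_le S (fun s hs i =>
      ⟨mem_nzLT_of_mem s hs i, mul_sub_ne_zero s hs i⟩) hu0 hm hv hu c).trans ?_
  gcongr
  exact (card_polysLT_filter_dvd_sub_le _ hF0 0).trans_eq (by rw [Nat.add_sub_cancel_left])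

theorem exists_dvd_add_of_mk_mul_eq_zero {K : Type*} [Field K] {F x z v : K[X]} (hF : F ≠ 0)
    (hx : IsCoprime x F) (hz : IsCoprime z F) (hv0 : v ≠ 0)
    (hv : AdjoinRoot.mk F v * ((AdjoinRoot.mk F x)⁻¹ʳ + (AdjoinRoot.mk F z)⁻¹ʳ) = 0) :
    ∃ d, d ∣ F ∧ F.natDegree - v.natDegree ≤ d.natDegree ∧ d ∣ x + z := by
  have hdvd : F ∣ v * (x + z) := by
    rw [← AdjoinRoot.mk_eq_zero, map_mul, map_add,
      ← mul_mul_eq_mul_add_of_mul_inverse_add_inverse_eq (isUnit_mk_iff.2 hx)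
        (isUnit_mk_iff.2 hz) hv, zero_mul, zero_mul]
  obtain ⟨e, d, he, hd, rfl⟩ := exists_dvd_and_dvd_of_dvd_mul hdvd
  refine ⟨d, dvd_mul_left d e, ?_, hd⟩
  rw [natDegree_mul (left_ne_zero_of_mul hF) (right_ne_zero_of_mul hF)]
  have := natDegree_le_of_dvd he hv0
  omega

open Classical in
theorem card_filter_dvd_add_le {d : K[X]} (hd : d ≠ 0) (m : ℕ) :
    #{s ∈ Fintype.piFinset fun _ : Fin 2 => polysLT K m | d ∣ s 0 + s 1} ≤
      Nat.card K ^ m * Nat.card K ^ (m - d.natDegree) := by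
  rw [mul_comm, ← card_polysLT K m]
  refine card_le_mul_card_image_of_maps_to (f := fun s => s 0)
    (fun s hs => Fintype.mem_piFinset.1 (mem_filter.1 hs).1 0) _ fun x _ => ?_
  refine (card_le_card_of_injOn (fun s => s 1) (fun s hs => ?_) fun s hs s' hs' h => ?_).trans
    (card_polysLT_filter_dvd_sub_le m hd (-x))
  · simp only [mem_coe, mem_filter, Fintype.mem_piFinset] at hs
    obtain ⟨⟨hs, hdvd⟩, rfl⟩ := hs
    exact mem_filter.2 ⟨hs 1, by rwa [sub_neg_eq_add, add_comm]⟩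
  · exact funext (Fin.forall_fin_two.2
      ⟨(mem_filter.1 hs).2.trans (mem_filter.1 hs').2.symm, h⟩)

open Classical in
theorem card_filter_exists_dvd_add_le (hF : F ≠ 0) (m e : ℕ) :
    #{s ∈ Fintype.piFinset fun _ : Fin 2 => coprimeLT F m |
        ∃ d, d ∣ F ∧ e ≤ d.natDegree ∧ d ∣ s 0 + s 1} ≤
      #(divs F) * (Nat.card K ^ m * Nat.card K ^ (m - e)) := by
  have hsub : {s ∈ Fintype.piFinset fun _ : Fin 2 => coprimeLT F m |
        ∃ d, d ∣ F ∧ e ≤ d.natDegree ∧ d ∣ s 0 + s 1} ⊆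
      ({d ∈ divs F | e ≤ d.natDegree}).biUnion fun d =>
        {s ∈ Fintype.piFinset fun _ : Fin 2 => polysLT K m | d ∣ s 0 + s 1} := by
    intro s hs
    obtain ⟨hs, d, hdF, hed, hd⟩ := mem_filter.1 hs
    exact mem_biUnion.2 ⟨d, mem_filter.2 ⟨(mem_divs hF).2 hdF, hed⟩, mem_filter.2
      ⟨Fintype.mem_piFinset.2 fun i => (mem_coprimeLT.1 (Fintype.mem_piFinset.1 hs i)).1, hd⟩⟩
  refine (card_le_card hsub).trans (card_biUnion_le.trans ((sum_le_card_nsmul _ _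
    (Nat.card K ^ m * Nat.card K ^ (m - e)) fun d hd => ?_).trans
    (Nat.mul_le_mul_right _ (card_filter_le _ _))))
  obtain ⟨hdF, hed⟩ := mem_filter.1 hd
  refine (card_filter_dvd_add_le (ne_zero_of_dvd_ne_zero hF ((mem_divs hF).1 hdF)) m).trans ?_
  gcongr
  exact Nat.card_pos

theorem card_sumReps_inverse_two_le_pow (hF : F ≠ 0) (hm : m ≤ F.natDegree) (y : AdjoinRoot F) :
    #(sumReps (coprimeLT F m) (fun x => (AdjoinRoot.mk F x)⁻¹ʳ) 2 y) ≤ Nat.card K ^ m := by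
  refine (card_sumReps_succ_le (card_coprimeLT_filter_inverse_eq_le hF m) 1 y).trans ?_
  rw [Nat.sub_eq_zero_of_le hm, pow_zero, one_mul, pow_one]
  exact card_coprimeLT_le F m

open Classical in
theorem card_sumReps_inverse_two_le_add_ite (hF0 : F ≠ 0) (hF : ¬ IsUnit F)
    (hm : m ≤ F.natDegree) (hx : x ∈ coprimeLT F m) (hz : z ∈ coprimeLT F m) :
    #(sumReps (coprimeLT F m) (fun x => (AdjoinRoot.mk F x)⁻¹ʳ) 2
        ((AdjoinRoot.mk F x)⁻¹ʳ + (AdjoinRoot.mk F z)⁻¹ʳ)) ≤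
      maxDivs K (4 * F.natDegree) * Nat.card K ^ ((3 * m + 1 - F.natDegree) / 2) +
        if ∃ d, d ∣ F ∧ F.natDegree - (m + F.natDegree) / 2 ≤ d.natDegree ∧ d ∣ x + z
          then Nat.card K ^ m else 0 := by
  obtain ⟨v, u, hv0, hv, hu, hvu⟩ := exists_mk_mul_eq_mk hF0
    ((AdjoinRoot.mk F x)⁻¹ʳ + (AdjoinRoot.mk F z)⁻¹ʳ) (a := (m + F.natDegree) / 2 + 1)
    (b := F.natDegree - (m + F.natDegree) / 2) (Nat.sub_le _ _) (by omega)
  rw [← natDegree_lt_iff_degree_lt hv0, Nat.lt_succ_iff] at hv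
  rcases eq_or_ne u 0 with rfl | hu0
  · obtain ⟨d, hdF, hdeg, hd⟩ := exists_dvd_add_of_mk_mul_eq_zero hF0 (mem_coprimeLT.1 hx).2
      (mem_coprimeLT.1 hz).2 hv0 (hvu.trans (map_zero _))
    rw [if_pos ⟨d, hdF, by omega, hd⟩]
    exact (card_sumReps_inverse_two_le_pow hF0 hm _).trans (Nat.le_add_left _ _)
  · exact (card_sumReps_inverse_two_le hF hm hu0 hv
      ((natDegree_lt_iff_degree_lt hu0).2 hu) hvu).trans (Nat.le_add_right _ _)

theorem energy_two_inverse_le (hF0 : F ≠ 0) (hF : ¬ IsUnit F) (hm : m ≤ F.natDegree) :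
    energy (coprimeLT F m) (fun x => (AdjoinRoot.mk F x)⁻¹ʳ) 2 ≤
      2 * maxDivs K (4 * F.natDegree) *
        Nat.card K ^ (2 * m + (3 * m + 1 - F.natDegree) / 2) := by
  classical
  set D := maxDivs K (4 * F.natDegree)
  set N := (3 * m + 1 - F.natDegree) / 2
  set P := Fintype.piFinset fun _ : Fin 2 => coprimeLT F m
  have hP : #P ≤ Nat.card K ^ (2 * m) := by
    rw [Fintype.card_piFinset_const, mul_comm, pow_mul]
    gcongr
    exact card_coprimeLT_le F m
  calc
    _ = ∑ s ∈ P, #(sumReps (coprimeLT F m) (fun x => (AdjoinRoot.mk F x)⁻¹ʳ) 2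
        ((AdjoinRoot.mk F (s 0))⁻¹ʳ + (AdjoinRoot.mk F (s 1))⁻¹ʳ)) := by
      simp only [energy_eq_sum, Fin.sum_univ_two, P]
    _ ≤ ∑ s ∈ P, (D * Nat.card K ^ N +
        if ∃ d, d ∣ F ∧ F.natDegree - (m + F.natDegree) / 2 ≤ d.natDegree ∧ d ∣ s 0 + s 1
          then Nat.card K ^ m else 0) := by
      refine sum_le_sum fun s hs => card_sumReps_inverse_two_le_add_ite hF0 hF hm ?_ ?_
      exacts [Fintype.mem_piFinset.1 hs 0, Fintype.mem_piFinset.1 hs 1]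
    _ = #P * (D * Nat.card K ^ N) +
        #{s ∈ P | ∃ d, d ∣ F ∧ F.natDegree - (m + F.natDegree) / 2 ≤ d.natDegree ∧
          d ∣ s 0 + s 1} * Nat.card K ^ m := by
      rw [sum_add_distrib, sum_const, smul_eq_mul, ← sum_filter, sum_const, smul_eq_mul]
    _ ≤ Nat.card K ^ (2 * m) * (D * Nat.card K ^ N) +
        D * (Nat.card K ^ m * Nat.card K ^ N) * Nat.card K ^ m := by
      gcongr
      refine (card_filter_exists_dvd_add_le hF0 m _).trans ?_
      gcongr
      · exact card_divs_le_maxDivs hF0 (by omega)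
      · exact Nat.card_pos
      · omega
    _ = _ := by ring

end SecondEnergy

section Asymptotics

open Finset
open scoped Ring

theorem one_lt_natCard_real (K : Type*) [Field K] [Finite K] : (1 : ℝ) < Nat.card K :=
  Nat.one_lt_cast.2 Finite.one_lt_card

theorem exists_maxDivs_pow_le (K : Type*) [Field K] [Finite K] {η : ℝ} (hη : 0 < η) (j l : ℕ) :
    ∃ C : ℝ, 0 < C ∧ ∀ N : ℕ, (maxDivs K (j * N) : ℝ) ^ l ≤ C * (Nat.card K : ℝ) ^ (η * N) := by
  have hq := one_lt_natCard_real K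
  obtain ⟨C, hC, h⟩ := exists_maxDivs_le K (η := η / (j * l + 1)) (by positivity)
  refine ⟨C ^ l, pow_pos hC l, fun N => ?_⟩
  calc
    _ ≤ (C * (Nat.card K : ℝ) ^ (η / (j * l + 1) * (j * N : ℕ))) ^ l := by
      gcongr
      exact h _
    _ = C ^ l * (Nat.card K : ℝ) ^ (η * N * (j * l / (j * l + 1))) := by
      rw [mul_pow, ← Real.rpow_mul_natCast (Nat.cast_nonneg _)]
      push_cast
      ring_nf
    _ ≤ C ^ l * (Nat.card K : ℝ) ^ (η * N) := by
      refine mul_le_mul_of_nonneg_left (Real.rpow_le_rpow_of_exponent_le hq.le ?_)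
        (by positivity)
      exact mul_le_of_le_one_right (by positivity)
        (div_le_one_of_le₀ (le_add_of_nonneg_right zero_le_one) (by positivity))

variable {K : Type*} [Field K] [Finite K] {F : K[X]}

theorem energy_inverse_le_of_natDegree_le (hF : F ≠ 0) {n k : ℕ} (hn : F.natDegree ≤ n)
    (hk : 0 < k) :
    (energy (coprimeLT F n) (fun x => (AdjoinRoot.mk F x)⁻¹ʳ) k : ℝ) ≤
      (Nat.card K : ℝ) ^ (2 * k * n - F.natDegree : ℝ) := by
  obtain ⟨l, rfl⟩ := Nat.exists_eq_succ_of_ne_zero hk.ne'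
  calc
    _ ≤ ((Nat.card K ^ (n - F.natDegree) * (Nat.card K ^ n) ^ (2 * l + 1) : ℕ) : ℝ) := by
      refine Nat.cast_le.2
        ((energy_succ_le (card_coprimeLT_filter_inverse_eq_le hF n) l).trans ?_)
      gcongr
      exact card_coprimeLT_le F n
    _ = (Nat.card K : ℝ) ^ ((n - F.natDegree + n * (2 * l + 1) : ℕ) : ℝ) := by
      rw [Real.rpow_natCast]
      push_cast
      ring
    _ = _ := by
      congr 1
      push_cast [Nat.cast_sub hn]
      ring

theorem two_mul_add_half_le {κ : ℝ} (hκ : κ ≤ 1 / 16) {r m : ℕ} (hm : r * (1 / 4 + κ) ≤ m) :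
    ((2 * m + (3 * m + 1 - r) / 2 : ℕ) : ℝ) ≤ 1 + (4 * m - (1 / 2 + κ) * r) - κ * r := by
  have : (0 : ℝ) ≤ r := r.cast_nonneg
  rcases le_total r (3 * m + 1) with h | h
  · have hnat : 2 * (2 * m + (3 * m + 1 - r) / 2) + r ≤ 7 * m + 1 := by omega
    have hreal : 2 * ((2 * m + (3 * m + 1 - r) / 2 : ℕ) : ℝ) + r ≤ 7 * m + 1 := by
      exact_mod_cast hnat
    nlinarith
  · rw [Nat.sub_eq_zero_of_le h]
    push_cast
    linarith

theorem exists_energy_two_inverse_le_of_lt (K : Type*) [Field K] [Finite K] {κ : ℝ} (hκ0 : 0 < κ)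
    (hκ : κ ≤ 1 / 16) :
    ∃ C : ℝ, 0 < C ∧ ∀ (F : K[X]) (m : ℕ), m < F.natDegree → F.natDegree * (1 / 4 + κ) ≤ m →
      (energy (coprimeLT F m) (fun x => (AdjoinRoot.mk F x)⁻¹ʳ) 2 : ℝ) ≤
        C * (Nat.card K : ℝ) ^ (4 * m - (1 / 2 + κ) * F.natDegree : ℝ) := by
  have hq := one_lt_natCard_real K
  have hq0 : (0 : ℝ) < Nat.card K := one_pos.trans hq
  obtain ⟨C, hC, h⟩ := exists_maxDivs_pow_le K hκ0 4 1
  refine ⟨2 * C * Nat.card K, by positivity, fun F m hmr hm => ?_⟩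
  calc
    _ ≤ ((2 * maxDivs K (4 * F.natDegree) *
        Nat.card K ^ (2 * m + (3 * m + 1 - F.natDegree) / 2) : ℕ) : ℝ) :=
      Nat.cast_le.2 (energy_two_inverse_le (ne_zero_of_natDegree_gt hmr)
        (not_isUnit_of_natDegree_pos F (Nat.zero_lt_of_lt hmr)) hmr.le)
    _ = 2 * (maxDivs K (4 * F.natDegree) : ℝ) ^ 1 *
        (Nat.card K : ℝ) ^ ((2 * m + (3 * m + 1 - F.natDegree) / 2 : ℕ) : ℝ) := by
      rw [Real.rpow_natCast]
      push_cast
      ring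
    _ ≤ 2 * (C * (Nat.card K : ℝ) ^ (κ * F.natDegree)) * (Nat.card K : ℝ) ^
        (1 + (4 * m - (1 / 2 + κ) * F.natDegree) - κ * F.natDegree : ℝ) := by
      gcongr
      · exact h _
      · exact hq.le
      · exact two_mul_add_half_le hκ hm
    _ = _ := by
      rw [Real.rpow_sub hq0, Real.rpow_add hq0, Real.rpow_one]
      field_simp

theorem exists_energy_two_inverse_le (K : Type*) [Field K] [Finite K] {κ : ℝ} (hκ0 : 0 < κ)
    (hκ : κ ≤ 1 / 16) :
    ∃ C : ℝ, 0 < C ∧ ∀ (F : K[X]) (m : ℕ), F ≠ 0 → F.natDegree * (1 / 4 + κ) ≤ m →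
      (energy (coprimeLT F m) (fun x => (AdjoinRoot.mk F x)⁻¹ʳ) 2 : ℝ) ≤
        C * (Nat.card K : ℝ) ^ (4 * m - (1 / 2 + κ) * F.natDegree : ℝ) := by
  obtain ⟨C, -, h⟩ := exists_energy_two_inverse_le_of_lt K hκ0 hκ
  refine ⟨max 1 C, by positivity, fun F m hF hm => ?_⟩
  rcases lt_or_ge m F.natDegree with hmr | hmr
  · refine (h F m hmr hm).trans ?_
    gcongr
    exact le_max_right _ _
  · refine (energy_inverse_le_of_natDegree_le hF hmr two_pos).trans
      (le_trans ?_ (le_mul_of_one_le_left (by positivity) (le_max_left _ _)))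
    refine Real.rpow_le_rpow_of_exponent_le (one_lt_natCard_real K).le ?_
    have : (0 : ℝ) ≤ F.natDegree := Nat.cast_nonneg _
    push_cast
    nlinarith

theorem mul_add_mul_sub_le {r n k : ℕ} (hk : 0 < k) (hle : r ≤ 2 * k * n)
    (hge : 2 * (k - 1) * n ≤ r) :
    ((k * n + ((2 * k - 1) * n - r) : ℕ) : ℝ) ≤ 2 * k * n - 1 / 2 * r := by
  obtain ⟨l, rfl⟩ := Nat.exists_eq_add_one_of_ne_zero hk.ne'
  have hnat : 2 * ((l + 1) * n + ((2 * (l + 1) - 1) * n - r)) + r ≤ 4 * ((l + 1) * n) := by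
    rw [Nat.add_sub_cancel] at hge
    rw [show 2 * (l + 1) - 1 = 2 * l + 1 by omega]
    ring_nf at hle hge ⊢
    omega
  have hreal : 2 * (((l + 1) * n + ((2 * (l + 1) - 1) * n - r) : ℕ) : ℝ) + r ≤
      4 * ((l + 1 : ℕ) * n) := by
    exact_mod_cast hnat
  linarith

theorem exists_energy_inverse_le_of_lt (K : Type*) [Field K] [Finite K] {η : ℝ} (hη : 0 < η)
    (L : ℕ) :
    ∃ C : ℝ, 0 < C ∧ ∀ (F : K[X]) (n k : ℕ), n < F.natDegree → 0 < k → k ≤ L →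
      F.natDegree ≤ 2 * k * n → 2 * (k - 1) * n ≤ F.natDegree →
      (energy (coprimeLT F n) (fun x => (AdjoinRoot.mk F x)⁻¹ʳ) k : ℝ) ≤
        C * (Nat.card K : ℝ) ^ (2 * k * n - (1 / 2 - η) * F.natDegree : ℝ) := by
  have hq := one_lt_natCard_real K
  have hq0 : (0 : ℝ) < Nat.card K := one_pos.trans hq
  obtain ⟨C, hC, h⟩ := exists_maxDivs_pow_le K hη 3 (2 * L + 1)
  refine ⟨2 * Nat.card K * C, by positivity, fun F n k hnr hk hkL hle hge => ?_⟩
  have hn : 0 < n := Nat.pos_of_ne_zero (by rintro rfl; omega)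
  have hkn : 2 * k * n ≤ 3 * F.natDegree := by
    obtain ⟨l, rfl⟩ := Nat.exists_eq_add_one_of_ne_zero hk.ne'
    rw [Nat.add_sub_cancel] at hge
    linarith
  have hdivs : maxDivs K (2 * k * n) ^ (2 * k + 1) ≤
      maxDivs K (3 * F.natDegree) ^ (2 * L + 1) :=
    (Nat.pow_le_pow_left (maxDivs_mono hkn) _).trans
      (Nat.pow_le_pow_right (maxDivs_pos _) (by omega))
  calc
    _ ≤ ((2 * Nat.card K * maxDivs K (3 * F.natDegree) ^ (2 * L + 1) *
        Nat.card K ^ (k * n + ((2 * k - 1) * n - F.natDegree)) : ℕ) : ℝ) :=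
      Nat.cast_le.2 ((energy_inverse_le (ne_zero_of_natDegree_gt hnr)
        (not_isUnit_of_natDegree_pos F (Nat.zero_lt_of_lt hnr)) hk hn).trans (by gcongr))
    _ = 2 * Nat.card K * (maxDivs K (3 * F.natDegree) : ℝ) ^ (2 * L + 1) *
        (Nat.card K : ℝ) ^ ((k * n + ((2 * k - 1) * n - F.natDegree) : ℕ) : ℝ) := by
      rw [Real.rpow_natCast]
      push_cast
      ring
    _ ≤ 2 * Nat.card K * (C * (Nat.card K : ℝ) ^ (η * F.natDegree)) *
        (Nat.card K : ℝ) ^ (2 * k * n - 1 / 2 * F.natDegree : ℝ) := by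
      gcongr
      · exact h _
      · exact hq.le
      · exact mul_add_mul_sub_le hk hle hge
    _ = _ := by
      rw [mul_assoc _ (C * _), mul_assoc C, ← Real.rpow_add hq0, ← mul_assoc]
      ring_nf

theorem exists_energy_inverse_le (K : Type*) [Field K] [Finite K] {η : ℝ} (hη : 0 < η) (L : ℕ) :
    ∃ C : ℝ, 0 < C ∧ ∀ (F : K[X]) (n k : ℕ), F ≠ 0 → 0 < k → k ≤ L →
      F.natDegree ≤ 2 * k * n → 2 * (k - 1) * n ≤ F.natDegree →
      (energy (coprimeLT F n) (fun x => (AdjoinRoot.mk F x)⁻¹ʳ) k : ℝ) ≤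
        C * (Nat.card K : ℝ) ^ (2 * k * n - (1 / 2 - η) * F.natDegree : ℝ) := by
  obtain ⟨C, -, h⟩ := exists_energy_inverse_le_of_lt K hη L
  refine ⟨max 1 C, by positivity, fun F n k hF hk hkL hle hge => ?_⟩
  rcases lt_or_ge n F.natDegree with hnr | hnr
  · refine (h F n k hnr hk hkL hle hge).trans ?_
    gcongr
    exact le_max_right _ _
  · refine (energy_inverse_le_of_natDegree_le hF hnr hk).trans
      (le_trans ?_ (le_mul_of_one_le_left (by positivity) (le_max_left _ _)))
    refine Real.rpow_le_rpow_of_exponent_le (one_lt_natCard_real K).le ?_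
    have : (0 : ℝ) ≤ F.natDegree := Nat.cast_nonneg _
    nlinarith

end Asymptotics

section BilinearSums

open Finset
open scoped Ring

theorem norm_bilinearSum_le_sq_mul {K : Type*} [Field K] [Finite K] {F a : K[X]} {m n : ℕ}
    {B X : ℝ} (hB : 0 < B)
    (h : ∀ α β : K[X] → ℂ, (∀ x : K[X], x.degree < m → ‖α x‖ ≤ 1) →
      (∀ x : K[X], x.degree < n → ‖β x‖ ≤ 1) → ‖bilinearSum F a m n α β‖ ≤ X)
    {α β : K[X] → ℂ} (hα : ∀ x : K[X], x.degree < m → ‖α x‖ ≤ B)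
    (hβ : ∀ x : K[X], x.degree < n → ‖β x‖ ≤ B) :
    ‖bilinearSum F a m n α β‖ ≤ B ^ 2 * X := by
  have norm_inv_mul_le (z : ℂ) (hz : ‖z‖ ≤ B) : ‖(B : ℂ)⁻¹ * z‖ ≤ 1 := by
    rwa [norm_mul, norm_inv, Complex.norm_of_nonneg hB.le, inv_mul_le_iff₀ hB, mul_one]
  have hsmul : bilinearSum F a m n α β = (B : ℂ) ^ 2 *
      bilinearSum F a m n (fun x => (B : ℂ)⁻¹ * α x) (fun x => (B : ℂ)⁻¹ * β x) := by
    have hB0 : (B : ℂ) ≠ 0 := Complex.ofReal_ne_zero.2 hB.ne'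
    simp only [bilinearSum, mul_sum]
    refine sum_congr rfl fun x _ => sum_congr rfl fun y _ => ?_
    field_simp
  rw [hsmul, norm_mul, norm_pow, Complex.norm_of_nonneg hB.le]
  gcongr
  exact h _ _ (fun x hx => norm_inv_mul_le _ (hα x hx)) fun x hx => norm_inv_mul_le _ (hβ x hx)

variable {K : Type*} [Field K] [Finite K] {F a : K[X]}

theorem bilinearSum_eq_sum_quotChar (F a : K[X]) (m n : ℕ) (α β : K[X] → ℂ) :
    bilinearSum F a m n α β = ∑ x ∈ coprimeLT F m, ∑ y ∈ coprimeLT F n, α x * β y *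
      quotChar F (AdjoinRoot.mk F a * (AdjoinRoot.mk F x)⁻¹ʳ * (AdjoinRoot.mk F y)⁻¹ʳ) := by
  refine sum_congr rfl fun x _ => sum_congr rfl fun y _ => ?_
  rw [← quotChar_mk, map_mul, mk_invMod, map_mul (AdjoinRoot.mk F) x, Ring.mul_inverse_rev,
    mul_assoc (AdjoinRoot.mk F a), mul_comm (AdjoinRoot.mk F y)⁻¹ʳ]

theorem norm_bilinearSum_pow_le (hF : F ≠ 0) (ha : IsCoprime a F) {m n k : ℕ} (hk : 0 < k)
    {α β : K[X] → ℂ} (hα : ∀ x : K[X], x.degree < m → ‖α x‖ ≤ 1)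
    (hβ : ∀ x : K[X], x.degree < n → ‖β x‖ ≤ 1) :
    ‖bilinearSum F a m n α β‖ ^ (4 * k) ≤
      ((Nat.card K : ℝ) ^ m) ^ (4 * (k - 1)) * (((Nat.card K : ℝ) ^ n) ^ (2 * k) *
        (energy (coprimeLT F n) (fun x => (AdjoinRoot.mk F x)⁻¹ʳ) k *
        ((Nat.card K : ℝ) ^ F.natDegree *
          energy (coprimeLT F m) (fun x => (AdjoinRoot.mk F x)⁻¹ʳ) 2))) := by
  have := finite_adjoinRoot hF
  have := Fintype.ofFinite (AdjoinRoot F)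
  obtain ⟨l, rfl⟩ := Nat.exists_eq_add_one_of_ne_zero hk.ne'
  have h := norm_bilinear_pow_le (quotChar_isPrimitive hF) (A := coprimeLT F m) (B := coprimeLT F n)
    (fun x => AdjoinRoot.mk F a * (AdjoinRoot.mk F x)⁻¹ʳ) (fun x => (AdjoinRoot.mk F x)⁻¹ʳ)
    (fun x hx => hα x (mem_polysLT.1 (mem_coprimeLT.1 hx).1))
    (fun x hx => hβ x (mem_polysLT.1 (mem_coprimeLT.1 hx).1)) l
  rw [← bilinearSum_eq_sum_quotChar, energy_mul_left _ _ _ (isUnit_mk_iff.2 ha),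
    ← Nat.card_eq_fintype_card, natCard_adjoinRoot hF] at h
  refine h.trans ?_
  have hcard (d : ℕ) : (#(coprimeLT F d) : ℝ) ≤ (Nat.card K : ℝ) ^ d := by
    exact_mod_cast card_coprimeLT_le F d
  push_cast
  gcongr <;> exact hcard _

theorem exists_two_mul_pred_mul_le {r n L : ℕ} (hL : 0 < L) (h : r ≤ 2 * L * n) :
    ∃ k, 0 < k ∧ k ≤ L ∧ r ≤ 2 * k * n ∧ 2 * (k - 1) * n ≤ r := by
  induction L, hL using Nat.le_induction with
  | base => exact ⟨1, one_pos, le_rfl, h, by simp⟩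
  | succ L _ ih =>
    rcases le_total r (2 * L * n) with hr | hr
    · obtain ⟨k, hk, hkL, hk'⟩ := ih hr
      exact ⟨k, hk, hkL.trans L.le_succ, hk'⟩
    · exact ⟨L + 1, L.succ_pos, le_rfl, h, hr⟩

theorem exists_norm_bilinearSum_pow_le (K : Type*) [Field K] [Finite K] {κ : ℝ} (hκ0 : 0 < κ)
    (hκ : κ ≤ 1 / 16) (L : ℕ) :
    ∃ C : ℝ, 0 < C ∧ ∀ (m n k : ℕ) (F a : K[X]) (α β : K[X] → ℂ), F ≠ 0 → IsCoprime a F →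
      0 < k → k ≤ L → F.natDegree ≤ 2 * k * n → 2 * (k - 1) * n ≤ F.natDegree →
      F.natDegree * (1 / 4 + κ) ≤ m →
      (∀ x : K[X], x.degree < m → ‖α x‖ ≤ 1) → (∀ x : K[X], x.degree < n → ‖β x‖ ≤ 1) →
      ‖bilinearSum F a m n α β‖ ^ (4 * k) ≤
        C * (Nat.card K : ℝ) ^ (4 * k * (m + n) - F.natDegree * (κ / 2) : ℝ) := by
  obtain ⟨C₁, hC₁, henergy₁⟩ := exists_energy_two_inverse_le K hκ0 hκ
  obtain ⟨C₂, hC₂, henergy₂⟩ := exists_energy_inverse_le K (half_pos hκ0) L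
  have hq0 : (0 : ℝ) < Nat.card K := one_pos.trans (one_lt_natCard_real K)
  refine ⟨C₁ * C₂, by positivity, fun m n k F a α β hF ha hk hkL hle hge hm hα hβ => ?_⟩
  calc
    _ ≤ _ := norm_bilinearSum_pow_le hF ha hk hα hβ
    _ ≤ ((Nat.card K : ℝ) ^ m) ^ (4 * (k - 1)) * (((Nat.card K : ℝ) ^ n) ^ (2 * k) *
        ((C₂ * (Nat.card K : ℝ) ^ (2 * k * n - (1 / 2 - κ / 2) * F.natDegree : ℝ)) *
          ((Nat.card K : ℝ) ^ F.natDegree *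
            (C₁ * (Nat.card K : ℝ) ^ (4 * m - (1 / 2 + κ) * F.natDegree : ℝ))))) := by
      gcongr
      · exact henergy₂ F n k hF hk hkL hle hge
      · exact henergy₁ F m hF hm
    _ = C₁ * C₂ * ((Nat.card K : ℝ) ^ (m * (4 * (k - 1)) : ℝ) *
        ((Nat.card K : ℝ) ^ (n * (2 * k) : ℝ) *
        ((Nat.card K : ℝ) ^ (2 * k * n - (1 / 2 - κ / 2) * F.natDegree : ℝ) *
          ((Nat.card K : ℝ) ^ (F.natDegree : ℝ) *
            (Nat.card K : ℝ) ^ (4 * m - (1 / 2 + κ) * F.natDegree : ℝ))))) := by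
      simp only [← Real.rpow_natCast, ← Real.rpow_mul hq0.le]
      push_cast [Nat.cast_sub hk]
      ring
    _ = _ := by
      simp only [← Real.rpow_add hq0]
      ring_nf

theorem exists_norm_bilinearSum_le_of_norm_le_one {ε : ℝ} (hε : 0 < ε) :
    ∃ δ : ℝ, 0 < δ ∧ ∀ (K : Type*) [Field K] [Finite K], ∃ C : ℝ, 0 < C ∧
      ∀ (m n : ℕ) (F a : K[X]), F ≠ 0 → IsCoprime a F →
        F.natDegree * ε ≤ n → F.natDegree * (1 / 4 + ε) ≤ m →
        ∀ α β : K[X] → ℂ, (∀ x : K[X], x.degree < m → ‖α x‖ ≤ 1) →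
          (∀ x : K[X], x.degree < n → ‖β x‖ ≤ 1) →
          ‖bilinearSum F a m n α β‖ ≤ C * (Nat.card K : ℝ) ^ (m + n - F.natDegree * δ : ℝ) := by
  obtain ⟨κ, hκ0, hκ, hκε⟩ : ∃ κ : ℝ, 0 < κ ∧ κ ≤ 1 / 16 ∧ κ ≤ ε :=
    ⟨min (1 / 16) ε, by positivity, min_le_left _ _, min_le_right _ _⟩
  set L := ⌈1 / (2 * ε)⌉₊
  have hL : 0 < L := Nat.ceil_pos.2 (by positivity)
  refine ⟨κ / (8 * L), by positivity, fun K _ _ => ?_⟩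
  have hq := one_lt_natCard_real K
  obtain ⟨C, -, h⟩ := exists_norm_bilinearSum_pow_le K hκ0 hκ L
  refine ⟨max 1 C, by positivity, fun m n F a hF ha hn hm α β hα hβ => ?_⟩
  have hrn : F.natDegree ≤ 2 * L * n := by
    have hεL : 1 ≤ L * (2 * ε) := (div_le_iff₀ (by positivity)).1 (Nat.le_ceil (1 / (2 * ε)))
    have : (F.natDegree : ℝ) ≤ 2 * L * n := by nlinarith
    exact_mod_cast this
  obtain ⟨k, hk, hkL, hle, hge⟩ := exists_two_mul_pred_mul_le hL hrn
  have hm' : F.natDegree * (1 / 4 + κ) ≤ m := hm.trans' (by gcongr)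
  refine le_of_pow_le_pow_left₀ (n := 4 * k) (by omega) (by positivity) ?_
  calc
    _ ≤ C * (Nat.card K : ℝ) ^ (4 * k * (m + n) - F.natDegree * (κ / 2) : ℝ) :=
      h m n k F a α β hF ha hk hkL hle hge hm' hα hβ
    _ ≤ max 1 C ^ (4 * k) * (Nat.card K : ℝ) ^
        (4 * k * (m + n) - F.natDegree * (κ / (8 * L)) * (4 * k) : ℝ) := by
      have hkL' : (k : ℝ) / L ≤ 1 := div_le_one_of_le₀ (Nat.cast_le.2 hkL) L.cast_nonneg
      gcongr ?_ * _ ^ (_ - ?_)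
      · exact (le_max_right 1 C).trans (le_self_pow₀ (le_max_left 1 C) (by omega))
      · exact hq.le
      · calc F.natDegree * (κ / (8 * L)) * (4 * k) = F.natDegree * (κ / 2) * (k / L) := by ring
          _ ≤ F.natDegree * (κ / 2) := mul_le_of_le_one_right (by positivity) hkL'
    _ = _ := by
      rw [mul_pow, ← Real.rpow_mul_natCast (Nat.cast_nonneg _)]
      push_cast
      ring_nf

theorem exists_forall_le_mul_add_of_isLittleO {φ : ℕ → ℝ}
    (hφ : φ =o[Filter.atTop] fun r : ℕ => (r : ℝ)) {c : ℝ} (hc : 0 < c) :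
    ∃ M : ℝ, ∀ r, φ r ≤ c * r + M := by
  obtain ⟨N, hN⟩ := Filter.eventually_atTop.1 (hφ.def hc)
  obtain ⟨M, hM⟩ := ((Set.finite_lt_nat N).image fun r => φ r).bddAbove
  refine ⟨max 0 M, fun r => ?_⟩
  rcases le_or_gt N r with hr | hr
  · calc
      φ r ≤ ‖φ r‖ := Real.le_norm_self _
      _ ≤ c * ‖(r : ℝ)‖ := hN r hr
      _ = c * r := by rw [Real.norm_natCast]
      _ ≤ _ := le_add_of_nonneg_right (le_max_left 0 M)
  · calc
      φ r ≤ M := hM (Set.mem_image_of_mem _ hr)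
      _ ≤ max 0 M := le_max_right 0 M
      _ ≤ _ := le_add_of_nonneg_left (by positivity)

end BilinearSums

end FqKloosterman

theorem theorem2p1_general {ε : ℝ} (hε : 0 < ε) :
    ∃ δ : ℝ, 0 < δ ∧ ∀ (K : Type*) [Field K] [Fintype K] (φ : ℕ → ℝ),
      (φ =o[Filter.atTop] fun r : ℕ => (r : ℝ)) → ∃ C : ℝ, 0 < C ∧
        ∀ (r m n : ℕ) (F a : K[X]) (α β : K[X] → ℂ),
          F.degree = r → IsCoprime a F → r * ε ≤ n → r * (1 / 4 + ε) ≤ m →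
          (∀ x : K[X], x.degree < m → ‖α x‖ ≤ (Fintype.card K : ℝ) ^ φ r) →
          (∀ x : K[X], x.degree < n → ‖β x‖ ≤ (Fintype.card K : ℝ) ^ φ r) →
          ‖FqKloosterman.bilinearSum F a m n α β‖ ≤
            C * (Fintype.card K : ℝ) ^ (m + n - r * δ : ℝ) := by
  obtain ⟨δ, hδ, hbound⟩ := FqKloosterman.exists_norm_bilinearSum_le_of_norm_le_one hε
  refine ⟨δ / 2, half_pos hδ, fun K _ _ φ hφ => ?_⟩
  obtain ⟨C, hC, hbound⟩ := hbound K
  obtain ⟨M, hM⟩ := FqKloosterman.exists_forall_le_mul_add_of_isLittleO hφ (c := δ / 4)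
    (by positivity)
  have hq : 1 < (Fintype.card K : ℝ) := Nat.one_lt_cast.2 Fintype.one_lt_card
  have hq0 : 0 < (Fintype.card K : ℝ) := one_pos.trans hq
  refine ⟨C * Fintype.card K ^ (2 * M), by positivity, ?_⟩
  intro r m n F a α β hF ha hn hm hα hβ
  obtain rfl : F.natDegree = r := natDegree_eq_of_degree_eq_some hF
  have hF0 : F ≠ 0 := degree_ne_bot.1 (hF ▸ WithBot.coe_ne_bot)
  rw [Nat.card_eq_fintype_card] at hbound
  refine (FqKloosterman.norm_bilinearSum_le_sq_mul (by positivity) (hbound m n F a hF0 ha hn hm)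
    hα hβ).trans ?_
  rw [mul_left_comm, mul_assoc, ← Real.rpow_mul_natCast hq0.le, ← Real.rpow_add hq0,
    ← Real.rpow_add hq0]
  refine mul_le_mul_of_nonneg_left (Real.rpow_le_rpow_of_exponent_le hq.le ?_) hC.le
  push_cast
  linarith [hM F.natDegree]

theorem theorem2p1 (ε : ℝ) (hε : 0 < ε) :
    ∃ δ : ℝ, 0 < δ ∧
      ∀ (K : Type*) [Field K] [Fintype K], Odd (Fintype.card K) →
      ∀ φ : ℕ → ℝ, (φ =o[Filter.atTop] fun r : ℕ => (r : ℝ)) →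
      ∃ C : ℝ, 0 < C ∧
        ∀ (r m n : ℕ) (F a : Polynomial K) (α β : Polynomial K → ℂ),
          F.degree = (r : WithBot ℕ) → IsCoprime a F →
          0 < n → 0 < m →
          (r : ℝ) * ε ≤ (n : ℝ) → (r : ℝ) * (1 / 4 + ε) ≤ (m : ℝ) →
          (∀ x : Polynomial K, x.degree < (m : WithBot ℕ) →
            ‖α x‖ ≤ (Fintype.card K : ℝ) ^ φ r) →
          (∀ x : Polynomial K, x.degree < (n : WithBot ℕ) →
            ‖β x‖ ≤ (Fintype.card K : ℝ) ^ φ r) →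
          ‖FqKloosterman.bilinearSum F a m n α β‖ ≤
            C * (Fintype.card K : ℝ) ^ ((m : ℝ) + (n : ℝ) - (r : ℝ) * δ) :=
  (theorem2p1_general hε).imp fun _ ⟨hδ, h⟩ => ⟨hδ, fun K _ _ _ φ hφ =>
    (h K φ hφ).imp fun _ ⟨hC, h⟩ => ⟨hC, fun r m n F a α β hF ha _ _ => h r m n F a α β hF ha⟩⟩
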